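/- **Setting.** A (cosimplicial) *descent category* is a category $\mathcal D$ with finite products, a saturated class $\mathrm E$ of morphisms (the *equivalences*; saturated: $\mathrm E$ consists of all morphisms that become invertible in $\mathcal D[\mathrm E^{-1}]$) with $\mathrm E\times\mathrm E\subset\mathrm E$, a *simple functor* $\mathbf s:\Delta\mathcal D\to\mathcal D$ on cosimplicial objects which sends degreewise equivalences to equivalences, and natural transformations $\mu:\mathbf s\mathbf s\to\mathbf s\mathrm D$ ($\mathrm D$ the diagonal of bicosimplicial objects) and $\lambda:\mathrm{id}_{\mathcal D}\to\mathbf s c$ ($c$ the constant cosimplicial object), such that: $\mathbf s(X\times Y)\to\mathbf s(X)\times\mathbf s(Y)$ and $\mathbf s(*)\to *$ are equivalences; $\mu_Z$ and $\lambda_A$ are equivalences; in $\mathcal D[\mathrm E^{-1}]$ both composites of $\mu$ with $\lambda_{\mathbf s(X)}$ and with $\mathbf s(\lambda_X)$ are the identity of $\mathbf s(X)$; and $\mathbf s(A^{\Delta[1]})\to\mathbf s(A^{\Delta[0]})$, induced by a vertex of $\Delta[1]$, is an equivalence. It is a *monoidal descent category* if $\mathcal D$ is symmetric monoidal, $\mathbf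 s$ is a lax symmetric monoidal functor and $\mu,\lambda$ are monoidal transformations. A triple $(\mathcal A,\mathcal S,\mathcal W)$ of a category with two classes of morphisms is *right Cartan–Eilenberg* if every morphism of $\mathcal S$ becomes invertible in $\mathcal A[\mathcal W^{-1}]$ and every object has a CE-fibrant model. Here $M$ is *CE-fibrant* if for all $w:Y\to X$ in $\mathcal W$ the map $w^*:\mathcal A[\mathcal S^{-1}](X,M)\to\mathcal A[\mathcal S^{-1}](Y,M)$ is bijective, and a *CE-fibrant model* of $X$ is a morphism $X\to M$ of $\mathcal A[\mathcal S^{-1}]$ with $M$ CE-fibrant that becomes invertible in $\mathcal A[\mathcal W^{-1}]$. Let $\mathcal X$ be a Grothendieck site and $(\mathcal D,\mathrm E,\mathbf s,\mu,\lambda)$ a monoidal descent category such that * (G0) $\mathcal X$ has a set $X$ of enough points; * (G1') $\mathcal D$ has all (small) filtered colimits and all (small) limits; * (G2) filtered colimits and products in $\mathcal D$ preserve equivalences; * (G3) $A\otimes-$ preserves filtered colimits for every $A\in\mathcal D$; * (G4) filtered colimits commute with finite limits in $\mathcal D$; and such that there is an associated sheaf functor $(\ )^a:\mathrm{PrSh}(\mathcal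 X,\mathcal D)\to\mathrm{Sh}(\mathcal X,\mathcal D)$ which makes $\mathrm{Sh}(\mathcal X,\mathcal D)$ a symmetric monoidal category with $\mathcal F\otimes\mathcal G$ the sheaf associated with the objectwise tensor product (that is, the morphisms inverted by $(\ )^a$ are stable under $\otimes$; this is automatic if $\mathcal D$ is closed). Let $T=p_*p^*$ be the Godement monad, where $p^*\mathcal F=(\mathcal F_x)_{x\in X}$ is the family of stalks and $p_*(A_x)$ is the product of the skyscraper sheaves $x_*A_x$, let $G^\bullet\mathcal F$, with $G^p\mathcal F=T^{p+1}\mathcal F$, be the cosimplicial Godement resolution, $\mathbb H_{\mathcal X}(\mathcal F)=\mathbf s\,G^\bullet\mathcal F$ the hypercohomology sheaf ($\mathbf s$ applied objectwise, followed by the associated sheaf functor), and $\rho_{\mathcal F}:\mathcal F\to\mathbb H_{\mathcal X}(\mathcal F)$ the morphism induced by $\lambda$ and the augmentation $\mathcal F\to G^\bullet\mathcal F$. On $\mathrm{Sh}(\mathcal X,\mathcal D)$ let $\mathcal S$ be the class of global equivalences (objectwise in $\mathrm E$) and $\mathcal W$ the class of local equivalences (stalkwise in $\mathrm E$). Since $\mathbb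 H_{\mathcal X}$ is lax symmetric monoidal and $\rho$ is monoidal, they induce endofunctors $\mathbb H_{\mathcal X}$ and transformations $\rho:\mathrm{id}\to\mathbb H_{\mathcal X}$ on the categories * $\mathrm{Op}^{\mathrm{Sh}(\mathcal X,\mathcal D)}$ of symmetric operads (in arities $l\ge 1$), * $\mathrm{Alg}^{\mathrm{Sh}(\mathcal X,\mathcal D)}$ of pairs $(P,\mathcal A)$ of an operad and a $P$-algebra, * $\mathrm{Alg}_P^{\mathrm{Sh}(\mathcal X,\mathcal D)}$ of algebras over a fixed operad $P$ (where $\mathbb H_{\mathcal X}(\mathcal A)$ is a $P$-algebra through $\rho_P:P\to\mathbb H_{\mathcal X}(P)$), on which $\mathcal S$ and $\mathcal W$ are defined arity-wise and on underlying sheaves. One of the categories $\mathcal A=\mathrm{Sh}(\mathcal X,\mathcal D)$, $\mathrm{Op}$, $\mathrm{Alg}$, $\mathrm{Alg}_P$ is *compatible* with $\mathcal X$ if $(\mathcal A,\mathcal S,\mathcal W)$ is a right Cartan–Eilenberg category and $\rho_{\mathcal F}:\mathcal F\to\mathbb H_{\mathcal X}(\mathcal F)$ is a CE-fibrant model for every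 object $\mathcal F$. **Theorem.** If $\mathrm{Sh}(\mathcal X,\mathcal D)$ is compatible with $\mathcal X$, then: 1. $\mathrm{Op}^{\mathrm{Sh}(\mathcal X,\mathcal D)}$, $\mathrm{Alg}^{\mathrm{Sh}(\mathcal X,\mathcal D)}$ and, for every operad $P$ in $\mathrm{Sh}(\mathcal X,\mathcal D)$, $\mathrm{Alg}_P^{\mathrm{Sh}(\mathcal X,\mathcal D)}$ are compatible with $\mathcal X$. 2. Let $f:\mathcal X\to\mathcal Y$ be a morphism of sites (given by a continuous functor $f^{-1}:\mathcal Y\to\mathcal X$), where $\mathcal Y$ is a site with a set of enough points and $\mathrm{Sh}(\mathcal Y,\mathcal D)$ is symmetric monoidal as above. Then the lax symmetric monoidal functor $f_*$ has right derived functors $\mathbb Rf_*(\mathcal F)=f_*\mathbb H_{\mathcal X}(\mathcal F)$, with unit induced by $\rho$, from $\mathrm{Sh}(\mathcal X,\mathcal D)[\mathcal W^{-1}]$ to $\mathrm{Sh}(\mathcal Y,\mathcal D)[\mathcal W^{-1}]$, from $\mathrm{Op}^{\mathrm{Sh}(\mathcal X,\mathcal D)}[\mathcal W^{-1}]$ to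 $\mathrm{Op}^{\mathrm{Sh}(\mathcal Y,\mathcal D)}[\mathcal W^{-1}]$, from $\mathrm{Alg}^{\mathrm{Sh}(\mathcal X,\mathcal D)}[\mathcal W^{-1}]$ to $\mathrm{Alg}^{\mathrm{Sh}(\mathcal Y,\mathcal D)}[\mathcal W^{-1}]$, and from $\mathrm{Alg}_P^{\mathrm{Sh}(\mathcal X,\mathcal D)}[\mathcal W^{-1}]$ to $\mathrm{Alg}_{f_*P}^{\mathrm{Sh}(\mathcal Y,\mathcal D)}[\mathcal W^{-1}]$ for every $P$. They commute with the forgetful functors: $(\mathbb Rf_*P)(l)=\mathbb Rf_*(P(l))$ for $l\ge1$, $\mathbb Rf_*(P,\mathcal A)=(\mathbb Rf_*P,\mathbb Rf_*\mathcal A)$, and the sheaf underlying $\mathbb Rf_*\mathcal A$ is $\mathbb Rf_*$ of the sheaf underlying $\mathcal A$. 3. For every object $U$ of $\mathcal X$ the same holds for the sections functor $\Gamma(U,-)$ and sheaf cohomology $\mathbb R\Gamma(U,\mathcal F)=\Gamma(U,\mathbb H_{\mathcal X}(\mathcal F))$, with values in the localizations of $\mathcal D$, $\mathrm{Op}^{\mathcal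 D}$, $\mathrm{Alg}^{\mathcal D}$ and $\mathrm{Alg}^{\mathcal D}_{\Gamma(U,P)}$ at the equivalences (arity-wise and on underlying objects). -/

import Mathlib

open CategoryTheory MonoidalCategory Limits Opposite

universe w v v₁ v₂ v₃ u u₁ u₂ u₃

namespace SheafOperad

noncomputable section

/-! ### Finite tensor products in a symmetric monoidal category -/

section Tensor

/-- The sum `m 0 + ⋯ + m (k - 1)`. -/
def tsum : {k : ℕ} → (Fin k → ℕ) → ℕ
  | 0, _ => 0
  | _ + 1, m => tsum (fun i => m i.succ) + m 0

/-- The position of the `j`-th element of the `i`-th block, when `m 0 + ⋯ + m (k - 1)` letters are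
cut into consecutive blocks of lengths `m 0, …, m (k - 1)`. -/
def idx : {k : ℕ} → (m : Fin k → ℕ) → (i : Fin k) → Fin (m i) → Fin (tsum m)
  | 0, _, i, _ => i.elim0
  | _ + 1, m, ⟨0, _⟩, j =>
      ⟨j.1, lt_of_lt_of_le j.2 (Nat.le_add_left (m 0) (tsum fun i => m i.succ))⟩
  | _ + 1, m, ⟨i + 1, h⟩, j =>
      (idx (fun i => m i.succ) ⟨i, Nat.lt_of_succ_lt_succ h⟩ j).addNat (m 0)

lemma idx_bijective : {k : ℕ} → (m : Fin k → ℕ) →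
    Function.Bijective (fun p : (Σ i, Fin (m i)) => idx m p.1 p.2)
  | 0, m => ⟨fun p => p.1.elim0, fun x => x.elim0⟩
  | k + 1, m => by
    have ih := idx_bijective (fun i : Fin k => m i.succ)
    constructor
    · rintro ⟨⟨i, hi⟩, j⟩ ⟨⟨i', hi'⟩, j'⟩ h
      have hv := congrArg Fin.val h
      match i, i', hi, hi', j, j', hv with
      | 0, 0, _, _, j, j', hv =>
        have : j = j' := Fin.ext hv
        subst this; rfl
      | 0, i' + 1, hi, _, j, j', hv =>
        exfalso
        have h1 : j.1 = _ + m 0 := hv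
        have h2 : j.1 < m 0 := j.2
        omega
      | i + 1, 0, _, hi', j, j', hv =>
        exfalso
        have h1 : _ + m 0 = j'.1 := hv
        have h2 : j'.1 < m 0 := j'.2
        omega
      | i + 1, i' + 1, hi, hi', j, j', hv =>
        have h1 : (idx (fun i : Fin k => m i.succ) ⟨i, Nat.lt_of_succ_lt_succ hi⟩ j).1 + m 0 =
          (idx (fun i : Fin k => m i.succ) ⟨i', Nat.lt_of_succ_lt_succ hi'⟩ j').1 + m 0 := hv
        have h2 := @ih.1 ⟨⟨i, Nat.lt_of_succ_lt_succ hi⟩, j⟩ ⟨⟨i', Nat.lt_of_succ_lt_succ hi'⟩, j'⟩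
          (Fin.ext (Nat.add_right_cancel h1))
        obtain ⟨h3, h4⟩ := Sigma.mk.inj_iff.1 h2
        obtain rfl : i = i' := congrArg Fin.val h3
        obtain rfl := eq_of_heq h4
        rfl
    · intro x
      by_cases hx : x.1 < m 0
      · exact ⟨⟨0, ⟨x.1, hx⟩⟩, rfl⟩
      · have hx2 : x.1 < tsum (fun i : Fin k => m i.succ) + m 0 := x.2
        obtain ⟨⟨i, j⟩, h⟩ := ih.2 ⟨x.1 - m 0, by omega⟩
        refine ⟨⟨i.succ, j⟩, Fin.ext ?_⟩
        have h1 : (idx (fun i : Fin k => m i.succ) i j).1 = x.1 - m 0 := congrArg Fin.val h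
        change (idx (fun i : Fin k => m i.succ) i j).1 + m 0 = x.1
        omega

/-- The lexicographic bijection `Σ i, Fin (m i) ≃ Fin (m 0 + ⋯ + m (k - 1))`. -/
def sigmaFin {k : ℕ} (m : Fin k → ℕ) : (Σ i, Fin (m i)) ≃ Fin (tsum m) :=
  Equiv.ofBijective _ (idx_bijective m)

lemma tsum_add (a b : ℕ) (f : Fin (b + a) → ℕ) :
    tsum f = tsum (fun i : Fin b => f (i.addNat a)) +
      tsum (fun j : Fin a => f ⟨j.1, lt_of_lt_of_le j.2 (Nat.le_add_left a b)⟩) := by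
  induction a with
  | zero => rfl
  | succ a ih =>
    change tsum (fun i : Fin (b + a) => f i.succ) + f 0 = _ + (tsum _ + f 0)
    rw [ih, Nat.add_assoc]
    rfl

lemma tsum_idx {k : ℕ} (m : Fin k → ℕ) (n : Fin (tsum m) → ℕ) :
    tsum (fun i => tsum (fun j => n (idx m i j))) = tsum n := by
  induction k with
  | zero => rfl
  | succ k ih =>
    exact (congrArg (· + _) (ih (fun i => m i.succ) (fun x => n (x.addNat (m 0))))).trans
      (tsum_add (m 0) (tsum fun i => m i.succ) n).symm

lemma tsum_pos {k : ℕ} (hk : 0 < k) (m : Fin k → ℕ) (hm : ∀ i, 0 < m i) : 0 < tsum m := by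
  cases k with
  | zero => omega
  | succ k => exact Nat.add_pos_right _ (hm 0)

lemma tsum_const_one (k : ℕ) : tsum (fun _ : Fin k => 1) = k := by
  induction k with
  | zero => rfl
  | succ k ih => exact congrArg (· + 1) ih

/-- The bijection which `σ` induces between the complements of `0` and of `σ 0`. -/
def tailEquiv {k k' : ℕ} (σ : Fin (k + 1) ≃ Fin (k' + 1)) : Fin k ≃ Fin k' :=
  Equiv.removeNone (((finSuccEquiv' 0).symm.trans σ).trans (finSuccEquiv' (σ 0)))

lemma succAbove_tailEquiv {k k' : ℕ} (σ : Fin (k + 1) ≃ Fin (k' + 1)) (i : Fin k) :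
    (σ 0).succAbove (tailEquiv σ i) = σ i.succ := by
  have hne : σ i.succ ≠ σ 0 := fun h => Fin.succ_ne_zero i (σ.injective h)
  obtain ⟨j, hj⟩ := Fin.exists_succAbove_eq hne
  have h : some (tailEquiv σ i) = (((finSuccEquiv' 0).symm.trans σ).trans (finSuccEquiv' (σ 0)))
      (some i) := by
    apply Equiv.removeNone_some
    refine ⟨j, ?_⟩
    simp [← hj]
  have h2 : (((finSuccEquiv' 0).symm.trans σ).trans (finSuccEquiv' (σ 0))) (some i) = some j := by
    simp [← hj]
  rw [h2] at h
  rw [Option.some.inj h, hj]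

/-- The increasing map `Fin k → Fin (k + 1)` that avoids `p`. -/
def skip : {k : ℕ} → Fin (k + 1) → Fin k → Fin (k + 1)
  | 0, _, j => j.elim0
  | _ + 1, ⟨0, _⟩, j => j.succ
  | _ + 1, ⟨_ + 1, _⟩, ⟨0, _⟩ => 0
  | _ + 1, ⟨p + 1, h⟩, ⟨j + 1, h'⟩ =>
      (skip ⟨p, Nat.lt_of_succ_lt_succ h⟩ ⟨j, Nat.lt_of_succ_lt_succ h'⟩).succ

lemma skip_eq_succAbove : {k : ℕ} → (p : Fin (k + 1)) → (j : Fin k) → skip p j = p.succAbove j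
  | 0, _, j => j.elim0
  | _ + 1, ⟨0, _⟩, j => by simp [skip]
  | k + 1, ⟨p + 1, h⟩, ⟨0, _⟩ =>
      (Fin.succ_succAbove_zero (⟨p, Nat.lt_of_succ_lt_succ h⟩ : Fin (k + 1))).symm
  | k + 1, ⟨p + 1, h⟩, ⟨j + 1, h'⟩ =>
      (congrArg Fin.succ (skip_eq_succAbove ⟨p, Nat.lt_of_succ_lt_succ h⟩
        ⟨j, Nat.lt_of_succ_lt_succ h'⟩)).trans
      (Fin.succ_succAbove_succ (⟨p, Nat.lt_of_succ_lt_succ h⟩ : Fin (k + 1))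
        ⟨j, Nat.lt_of_succ_lt_succ h'⟩).symm

lemma skip_tailEquiv {k k' : ℕ} (σ : Fin (k + 1) ≃ Fin (k' + 1)) (i : Fin k) :
    skip (σ 0) (tailEquiv σ i) = σ i.succ := by
  rw [skip_eq_succAbove, succAbove_tailEquiv]

variable {C : Type u₁} [Category.{v₁} C] [MonoidalCategory C]

/-- The tensor product `X 0 ⊗ (X 1 ⊗ ⋯)`. -/
def tens : {k : ℕ} → (Fin k → C) → C
  | 0, _ => 𝟙_ C
  | _ + 1, X => X 0 ⊗ tens (fun i => X i.succ)

/-- The tensor product of a finite family of morphisms. -/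
def tensMap : {k : ℕ} → {X Y : Fin k → C} → (∀ i, X i ⟶ Y i) → (tens X ⟶ tens Y)
  | 0, _, _, _ => 𝟙 (𝟙_ C)
  | _ + 1, _, _, f => f 0 ⊗ₘ tensMap (fun i => f i.succ)

/-- The coherence isomorphism `𝟙 ⟶ 𝟙 ⊗ (𝟙 ⊗ ⋯)`. -/
def tensUnit : (k : ℕ) → (𝟙_ C ⟶ tens (fun _ : Fin k => 𝟙_ C))
  | 0 => 𝟙 (𝟙_ C)
  | k + 1 => tensUnit k ≫ (λ_ (tens (fun _ : Fin k => 𝟙_ C))).inv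

/-- The coherence isomorphism between an object and a tensor product with one factor. -/
def tensOne (X : C) : X ⟶ tens (fun _ : Fin 1 => X) := (ρ_ X).inv

/-- The associativity isomorphism which separates the first `a` factors from the others. -/
def tensSplit : (a : ℕ) → {b : ℕ} → (X : Fin (b + a) → C) →
    (tens X ⟶ tens (fun j : Fin a => X ⟨j.1, lt_of_lt_of_le j.2 (Nat.le_add_left a b)⟩) ⊗
      tens (fun i : Fin b => X (i.addNat a)))
  | 0, b, X => (λ_ (tens X)).inv
  | a + 1, b, X => (X 0 ◁ tensSplit a (b := b) (fun i => X i.succ)) ≫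
      (α_ (X 0) (tens (fun j : Fin a => X ⟨j.1 + 1, by omega⟩))
        (tens (fun i : Fin b => X (i.addNat (a + 1))))).inv


/-! ### Compatibility with lax monoidal functors -/

section LaxTens

open Functor.LaxMonoidal

@[simp]
lemma tensMap_id : {k : ℕ} → (X : Fin k → C) → tensMap (fun i => 𝟙 (X i)) = 𝟙 (tens X)
  | 0, _ => rfl
  | k + 1, X => by
    change 𝟙 (X 0) ⊗ₘ tensMap (fun i : Fin k => 𝟙 (X i.succ)) = _
    rw [tensMap_id]
    exact id_tensorHom_id _ _

lemma tensMap_comp : {k : ℕ} → {X Y Z : Fin k → C} → (f : ∀ i, X i ⟶ Y i) → (g : ∀ i, Y i ⟶ Z i) →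
    tensMap (fun i => f i ≫ g i) = tensMap f ≫ tensMap g
  | 0, _, _, _, _, _ => (Category.id_comp _).symm
  | k + 1, X, Y, Z, f, g => by
    change (f 0 ≫ g 0) ⊗ₘ tensMap (fun i : Fin k => f i.succ ≫ g i.succ) =
      (f 0 ⊗ₘ tensMap fun i : Fin k => f i.succ) ≫ (g 0 ⊗ₘ tensMap fun i : Fin k => g i.succ)
    rw [tensMap_comp, tensorHom_comp_tensorHom]

variable {C' : Type u₂} [Category.{v₂} C'] [MonoidalCategory C']

/-- The morphism `⨂ i, F (X i) ⟶ F (⨂ i, X i)` of a lax monoidal functor. -/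
def laxTens (F : C ⥤ C') [F.LaxMonoidal] : {k : ℕ} → (X : Fin k → C) →
    (tens (fun i => F.obj (X i)) ⟶ F.obj (tens X))
  | 0, _ => ε F
  | _ + 1, X => (F.obj (X 0) ◁ laxTens F (fun i => X i.succ)) ≫ μ F (X 0) (tens fun i => X i.succ)

lemma laxTens_natural (F : C ⥤ C') [F.LaxMonoidal] : {k : ℕ} → {X Y : Fin k → C} →
    (f : ∀ i, X i ⟶ Y i) →
    tensMap (fun i => F.map (f i)) ≫ laxTens F Y = laxTens F X ≫ F.map (tensMap f)
  | 0, _, _, _ => by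
    change 𝟙 _ ≫ ε F = ε F ≫ F.map (𝟙 _)
    simp
  | k + 1, X, Y, f => by
    change (F.map (f 0) ⊗ₘ tensMap fun i : Fin k => F.map (f i.succ)) ≫
      (F.obj (Y 0) ◁ laxTens F (fun i => Y i.succ)) ≫ μ F (Y 0) (tens fun i => Y i.succ) =
      ((F.obj (X 0) ◁ laxTens F (fun i => X i.succ)) ≫ μ F (X 0) (tens fun i => X i.succ)) ≫
        F.map (f 0 ⊗ₘ tensMap fun i : Fin k => f i.succ)
    rw [Category.assoc, ← μ_natural, ← id_tensorHom, ← id_tensorHom,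
      tensorHom_comp_tensorHom_assoc, tensorHom_comp_tensorHom_assoc, laxTens_natural]
    simp

lemma laxTens_app {F G : C ⥤ C'} [F.LaxMonoidal] [G.LaxMonoidal] (τ : F ⟶ G)
    [NatTrans.IsMonoidal τ] : {k : ℕ} → (X : Fin k → C) →
    tensMap (fun i => τ.app (X i)) ≫ laxTens G X = laxTens F X ≫ τ.app (tens X)
  | 0, _ => by
    change 𝟙 _ ≫ ε G = ε F ≫ τ.app (𝟙_ C)
    simp
  | k + 1, X => by
    change (τ.app (X 0) ⊗ₘ tensMap fun i : Fin k => τ.app (X i.succ)) ≫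
      (G.obj (X 0) ◁ laxTens G (fun i => X i.succ)) ≫ μ G (X 0) (tens fun i => X i.succ) =
      ((F.obj (X 0) ◁ laxTens F (fun i => X i.succ)) ≫ μ F (X 0) (tens fun i => X i.succ)) ≫
        τ.app (X 0 ⊗ tens fun i : Fin k => X i.succ)
    rw [Category.assoc, NatTrans.IsMonoidal.tensor, ← id_tensorHom, ← id_tensorHom,
      tensorHom_comp_tensorHom_assoc, tensorHom_comp_tensorHom_assoc, laxTens_app]
    simp

lemma laxTens_unit (F : C ⥤ C') [F.LaxMonoidal] : (k : ℕ) →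
    tensUnit k ≫ tensMap (fun _ => ε F) ≫ laxTens F (fun _ : Fin k => 𝟙_ C) =
      ε F ≫ F.map (tensUnit k)
  | 0 => by
    change 𝟙 _ ≫ 𝟙 _ ≫ ε F = ε F ≫ F.map (𝟙 _)
    simp
  | k + 1 => by
    change (tensUnit k ≫ (λ_ _).inv) ≫ (ε F ⊗ₘ tensMap fun _ : Fin k => ε F) ≫
      (F.obj (𝟙_ C) ◁ laxTens F (fun _ => 𝟙_ C)) ≫ μ F (𝟙_ C) (tens fun _ => 𝟙_ C) =
      ε F ≫ F.map (tensUnit k ≫ (λ_ _).inv)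
    have ih := laxTens_unit F k
    rw [F.map_comp, ← reassoc_of% ih, ← left_unitality_inv, leftUnitor_inv_naturality_assoc,
      leftUnitor_inv_naturality_assoc, tensorHom_def']
    simp only [Category.assoc, ← whisker_exchange_assoc]

lemma laxTens_split_aux (F : C ⥤ C') [F.LaxMonoidal] {X T U V : C} {T' U' V' : C'}
    (t : T' ⟶ F.obj T) (p : U' ⟶ F.obj U) (q : V' ⟶ F.obj V) (s : T ⟶ U ⊗ V) (s' : T' ⟶ U' ⊗ V')
    (h : t ≫ F.map s = s' ≫ (p ⊗ₘ q) ≫ μ F U V) :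
    ((F.obj X ◁ t) ≫ μ F X T) ≫ F.map ((X ◁ s) ≫ (α_ X U V).inv) =
      ((F.obj X ◁ s') ≫ (α_ (F.obj X) U' V').inv) ≫
        (((F.obj X ◁ p) ≫ μ F X U) ⊗ₘ q) ≫ μ F (X ⊗ U) V := by
  rw [F.map_comp, Category.assoc, ← μ_natural_right_assoc, ← whiskerLeft_comp_assoc, h]
  simp only [whiskerLeft_comp, Category.assoc, associativity_inv]
  simp [MonoidalCategory.tensorHom_def, ← whisker_exchange_assoc]

lemma laxTens_split (F : C ⥤ C') [F.LaxMonoidal] : (a : ℕ) → {b : ℕ} → (X : Fin (b + a) → C) →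
    laxTens F X ≫ F.map (tensSplit a X) =
      tensSplit a (fun i => F.obj (X i)) ≫ (laxTens F _ ⊗ₘ laxTens F _) ≫ μ F _ _
  | 0, b, X => by
    change laxTens F X ≫ F.map (λ_ (tens X)).inv = (λ_ _).inv ≫ (ε F ⊗ₘ laxTens F X) ≫ μ F _ _
    rw [← left_unitality_inv, leftUnitor_inv_naturality_assoc, tensorHom_def', Category.assoc]
  | a + 1, b, X => by
    have ih := laxTens_split F a (b := b) (fun i => X i.succ)
    change ((F.obj (X 0) ◁ laxTens F (fun i => X i.succ)) ≫ μ F (X 0) (tens fun i => X i.succ)) ≫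
      F.map ((X 0 ◁ tensSplit a (b := b) (fun i => X i.succ)) ≫ (α_ _ _ _).inv) =
      ((F.obj (X 0) ◁ tensSplit a (b := b) (fun i => F.obj (X i.succ))) ≫ (α_ _ _ _).inv) ≫
      (((F.obj (X 0) ◁ laxTens F _) ≫ μ F _ _) ⊗ₘ laxTens F _) ≫ μ F _ _
    exact laxTens_split_aux F _ _ _ _ _ ih

lemma laxTens_one (F : C ⥤ C') [F.LaxMonoidal] (X : C) :
    tensOne (F.obj X) ≫ laxTens F (fun _ : Fin 1 => X) = F.map (tensOne X) :=
  right_unitality_inv F X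

lemma tensOne_natural {X Y : C} (f : X ⟶ Y) :
    tensOne X ≫ tensMap (fun _ : Fin 1 => f) = f ≫ tensOne Y := by
  change (ρ_ X).inv ≫ (f ⊗ₘ 𝟙 (𝟙_ C)) = f ≫ (ρ_ Y).inv
  simp

lemma laxTens_id : {k : ℕ} → (X : Fin k → C) → laxTens (𝟭 C) X = 𝟙 (tens X)
  | 0, _ => rfl
  | k + 1, X => by
    change (X 0 ◁ laxTens (𝟭 C) (fun i => X i.succ)) ≫ 𝟙 _ = _
    rw [laxTens_id]
    exact (Category.comp_id _).trans (whiskerLeft_id _ _)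

lemma laxTens_app_id {G : C ⥤ C} [G.LaxMonoidal] (τ : 𝟭 C ⟶ G)
    [NatTrans.IsMonoidal τ] {k : ℕ} (X : Fin k → C) :
    tensMap (fun i => τ.app (X i)) ≫ laxTens G X = τ.app (tens X) := by
  rw [laxTens_app, laxTens_id]
  exact Category.id_comp _

end LaxTens

section Braided

variable [BraidedCategory C]

/-- The symmetry isomorphism
`(⨂ i, A i) ⊗ (⨂ x, B x) ⟶ ⨂ i, (A i ⊗ ⨂ j, B (i, j))`, where the factors `B x` are cut into
consecutive blocks of lengths `m 0, m 1, …`. -/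
def shuffle : {k : ℕ} → (m : Fin k → ℕ) → (A : Fin k → C) → (B : Fin (tsum m) → C) →
    (tens A ⊗ tens B ⟶ tens (fun i => A i ⊗ tens (fun j => B (idx m i j))))
  | 0, _, _, _ => (λ_ (𝟙_ C)).hom
  | _ + 1, m, A, B =>
      (tens A ◁ tensSplit (m 0) B) ≫
      tensorμ (A 0) (tens fun i => A i.succ)
        (tens fun j : Fin (m 0) => B (idx m 0 j))
        (tens fun i : Fin (tsum fun i => m i.succ) => B (i.addNat (m 0))) ≫
      ((A 0 ⊗ tens fun j : Fin (m 0) => B (idx m 0 j)) ◁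
        shuffle (fun i => m i.succ) (fun i => A i.succ) (fun i => B (i.addNat (m 0))))

lemma shuffle_natural_aux {A A' T T' B V W S S' : C} (a : A ⟶ A') (t : T ⟶ T') (d : B ⟶ V ⊗ W)
    (s : T ⊗ W ⟶ S) (s' : T' ⊗ W ⟶ S') (r : S ⟶ S') (h : (t ▷ W) ≫ s' = s ≫ r) :
    ((a ⊗ₘ t) ▷ B) ≫ ((A' ⊗ T') ◁ d) ≫ tensorμ A' T' V W ≫ ((A' ⊗ V) ◁ s') =
      (((A ⊗ T) ◁ d) ≫ tensorμ A T V W ≫ ((A ⊗ V) ◁ s)) ≫ ((a ▷ V) ⊗ₘ r) := by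
  rw [← whisker_exchange_assoc, tensorμ_natural_left_assoc]
  simp only [Category.assoc]
  congr 2
  rw [← id_tensorHom, ← id_tensorHom, tensorHom_comp_tensorHom, tensorHom_comp_tensorHom, h]
  simp

lemma shuffle_natural : {k : ℕ} → (m : Fin k → ℕ) → {A A' : Fin k → C} → (f : ∀ i, A i ⟶ A' i) →
    (B : Fin (tsum m) → C) →
    (tensMap f ▷ tens B) ≫ shuffle m A' B =
      shuffle m A B ≫ tensMap (fun i => f i ▷ tens (fun j => B (idx m i j)))
  | 0, _, _, _, _, _ => by
    change (𝟙 _ ▷ _) ≫ (λ_ (𝟙_ C)).hom = (λ_ (𝟙_ C)).hom ≫ 𝟙 _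
    simp
  | k + 1, m, A, A', f, B => by
    have ih := shuffle_natural (fun i => m i.succ) (fun i => f i.succ) (fun i => B (i.addNat (m 0)))
    exact shuffle_natural_aux _ _ _ _ _ _ ih

/-- The symmetry isomorphism which moves the factor `X p` to the front. -/
def extract : {k : ℕ} → (p : Fin (k + 1)) → (X : Fin (k + 1) → C) →
    (tens X ⟶ X p ⊗ tens (fun j => X (skip p j)))
  | 0, ⟨0, _⟩, X => 𝟙 (X 0 ⊗ 𝟙_ C)
  | k + 1, ⟨0, _⟩, X => 𝟙 (X 0 ⊗ tens (fun j : Fin (k + 1) => X j.succ))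
  | _ + 1, ⟨p + 1, h⟩, X =>
      (X 0 ◁ extract ⟨p, Nat.lt_of_succ_lt_succ h⟩ (fun i => X i.succ)) ≫
      (α_ _ _ _).inv ≫ ((β_ (X 0) (X ⟨p + 1, h⟩)).hom ▷ _) ≫ (α_ _ _ _).hom

/-- The symmetry isomorphism `⨂ i, X i ⟶ ⨂ i, X (σ i)` that reorders the factors. -/
def permTens : {k k' : ℕ} → (σ : Fin k ≃ Fin k') → (X : Fin k' → C) →
    (tens X ⟶ tens (fun i => X (σ i)))
  | 0, 0, _, _ => 𝟙 (𝟙_ C)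
  | 0, _ + 1, σ, _ => (σ.symm 0).elim0
  | _ + 1, 0, σ, _ => (σ 0).elim0
  | _ + 1, _ + 1, σ, X => extract (σ 0) X ≫
      (X (σ 0) ◁ (permTens (tailEquiv σ) (fun j => X (skip (σ 0) j)) ≫
        tensMap (fun i => eqToHom (congrArg X (skip_tailEquiv σ i)))))


open Functor.LaxMonoidal

variable {C' : Type u₂} [Category.{v₂} C'] [MonoidalCategory C'] [BraidedCategory C']

lemma laxTens_shuffle_aux (F : C ⥤ C') [F.LaxBraided] {X T U V W S : C}
    {T' U' V' W' S' Z' : C'}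
    (t : T' ⟶ F.obj T) (u : U' ⟶ F.obj U) (p : V' ⟶ F.obj V) (q : W' ⟶ F.obj W)
    (d : U ⟶ V ⊗ W) (d' : U' ⟶ V' ⊗ W') (s : T ⊗ W ⟶ S) (s' : T' ⊗ W' ⟶ S')
    (r : S' ⟶ Z') (z : Z' ⟶ F.obj S)
    (hd : u ≫ F.map d = d' ≫ (p ⊗ₘ q) ≫ μ F V W)
    (hs : (t ⊗ₘ q) ≫ μ F T W ≫ F.map s = s' ≫ r ≫ z) :
    (((F.obj X ◁ t) ≫ μ F X T) ⊗ₘ u) ≫ μ F (X ⊗ T) U ≫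
        F.map (((X ⊗ T) ◁ d) ≫ tensorμ X T V W ≫ ((X ⊗ V) ◁ s)) =
      (((F.obj X ⊗ T') ◁ d') ≫ tensorμ (F.obj X) T' V' W' ≫ ((F.obj X ⊗ V') ◁ s')) ≫
      (((F.obj X ◁ p) ≫ μ F X V) ⊗ₘ r) ≫ (F.obj (X ⊗ V) ◁ z) ≫ μ F (X ⊗ V) S := by
  have h1 : (((F.obj X ◁ t) ≫ μ F X T) ⊗ₘ u) ≫ μ F (X ⊗ T) U ≫ F.map ((X ⊗ T) ◁ d) =
      ((F.obj X ⊗ T') ◁ d') ≫ ((F.obj X ◁ t) ⊗ₘ (p ⊗ₘ q)) ≫ (μ F X T ⊗ₘ μ F V W) ≫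
        μ F (X ⊗ T) (V ⊗ W) := by
    rw [← μ_natural_right, ← id_tensorHom (F.obj (X ⊗ T)) (F.map d),
      tensorHom_comp_tensorHom_assoc, hd, ← id_tensorHom (F.obj X ⊗ T') d',
      tensorHom_comp_tensorHom_assoc, tensorHom_comp_tensorHom_assoc]
    simp
  have h2 : ((F.obj X ◁ t) ⊗ₘ (p ⊗ₘ q)) ≫ tensorμ (F.obj X) (F.obj T) (F.obj V) (F.obj W) =
      tensorμ (F.obj X) T' V' W' ≫ ((F.obj X ◁ p) ⊗ₘ (t ⊗ₘ q)) := by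
    rw [← id_tensorHom, tensorμ_natural, id_tensorHom]
  have ht := tensorμ_comp_μ_tensorHom_μ_comp_μ F X T V W
  rw [F.map_comp, F.map_comp, reassoc_of% h1, ← reassoc_of% ht, reassoc_of% h2,
    ← μ_natural_right]
  simp only [Category.assoc]
  congr 2
  rw [← id_tensorHom (F.obj (X ⊗ V)) (F.map s), ← id_tensorHom (F.obj X ⊗ V') s',
    ← id_tensorHom (F.obj (X ⊗ V)) z]
  simp only [tensorHom_comp_tensorHom_assoc, hs, Category.comp_id, Category.id_comp]

lemma laxTens_shuffle (F : C ⥤ C') [F.LaxBraided] : {k : ℕ} → (m : Fin k → ℕ) → (A : Fin k → C) →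
    (B : Fin (tsum m) → C) →
    (laxTens F A ⊗ₘ laxTens F B) ≫ μ F _ _ ≫ F.map (shuffle m A B) =
      shuffle m (fun i => F.obj (A i)) (fun x => F.obj (B x)) ≫
        tensMap (fun i => (F.obj (A i) ◁ laxTens F (fun j => B (idx m i j))) ≫ μ F _ _) ≫
        laxTens F _
  | 0, m, A, B => by
    change (ε F ⊗ₘ ε F) ≫ μ F _ _ ≫ F.map (λ_ (𝟙_ C)).hom =
      (λ_ (𝟙_ C')).hom ≫ 𝟙 _ ≫ ε F
    rw [tensorHom_def', Category.assoc, ← left_unitality]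
    simp
  | k + 1, m, A, B => by
    have ih := laxTens_shuffle F (fun i => m i.succ) (fun i => A i.succ)
      (fun i => B (i.addNat (m 0)))
    have hs := laxTens_split F (m 0) (b := tsum fun i => m i.succ) B
    exact laxTens_shuffle_aux F _ _ _ _ _ _ _ _ _ _ hs ih

lemma laxTens_extract_aux (F : C ⥤ C') [F.LaxBraided] {X T Y R : C} {T' R' : C'}
    (t : T' ⟶ F.obj T) (r : R' ⟶ F.obj R) (e : T ⟶ Y ⊗ R) (e' : T' ⟶ F.obj Y ⊗ R')
    (h : t ≫ F.map e = e' ≫ (F.obj Y ◁ r) ≫ μ F Y R) :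
    ((F.obj X ◁ t) ≫ μ F X T) ≫
        F.map ((X ◁ e) ≫ (α_ X Y R).inv ≫ ((β_ X Y).hom ▷ R) ≫ (α_ Y X R).hom) =
      ((F.obj X ◁ e') ≫ (α_ (F.obj X) (F.obj Y) R').inv ≫
        ((β_ (F.obj X) (F.obj Y)).hom ▷ R') ≫ (α_ (F.obj Y) (F.obj X) R').hom) ≫
        (F.obj Y ◁ ((F.obj X ◁ r) ≫ μ F X R)) ≫ μ F Y (X ⊗ R) := by
  simp only [F.map_comp, Category.assoc]
  rw [← μ_natural_right_assoc, ← whiskerLeft_comp_assoc, h]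
  simp only [whiskerLeft_comp, Category.assoc]
  rw [associativity_inv_assoc, ← μ_natural_left_assoc, ← comp_whiskerRight_assoc,
    Functor.LaxBraided.braided, comp_whiskerRight_assoc]
  rw [associativity, associator_inv_naturality_right_assoc, whisker_exchange_assoc,
    associator_naturality_right_assoc]

lemma laxTens_extract (F : C ⥤ C') [F.LaxBraided] : {k : ℕ} → (p : Fin (k + 1)) →
    (X : Fin (k + 1) → C) →
    laxTens F X ≫ F.map (extract p X) =
      extract p (fun i => F.obj (X i)) ≫ (F.obj (X p) ◁ laxTens F (fun j => X (skip p j))) ≫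
        μ F _ _
  | 0, ⟨0, _⟩, X => by
    change ((F.obj (X 0) ◁ ε F) ≫ μ F (X 0) (𝟙_ C)) ≫ F.map (𝟙 _) =
      𝟙 _ ≫ (F.obj (X 0) ◁ ε F) ≫ μ F (X 0) (𝟙_ C)
    simp
  | k + 1, ⟨0, _⟩, X => by
    change ((F.obj (X 0) ◁ laxTens F (fun i : Fin (k + 1) => X i.succ)) ≫ μ F (X 0) _) ≫
        F.map (𝟙 _) =
      𝟙 _ ≫ (F.obj (X 0) ◁ laxTens F (fun i : Fin (k + 1) => X i.succ)) ≫ μ F (X 0) _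
    simp
  | k + 1, ⟨p + 1, h⟩, X => by
    have ih := laxTens_extract F (⟨p, Nat.lt_of_succ_lt_succ h⟩ : Fin (k + 1)) (fun i => X i.succ)
    exact laxTens_extract_aux F _ _ _ _ ih

lemma laxTens_perm (F : C ⥤ C') [F.LaxBraided] : {k k' : ℕ} → (σ : Fin k ≃ Fin k') →
    (X : Fin k' → C) →
    laxTens F X ≫ F.map (permTens σ X) =
      permTens σ (fun i => F.obj (X i)) ≫ laxTens F (fun i => X (σ i))
  | 0, 0, _, _ => by
    change ε F ≫ F.map (𝟙 _) = 𝟙 _ ≫ ε F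
    simp
  | 0, _ + 1, σ, _ => (σ.symm 0).elim0
  | _ + 1, 0, σ, _ => (σ 0).elim0
  | k + 1, k' + 1, σ, X => by
    have ih := laxTens_perm F (tailEquiv σ) (fun j => X (skip (σ 0) j))
    have hx := laxTens_extract F (σ 0) X
    change laxTens F X ≫ F.map (extract (σ 0) X ≫
      (X (σ 0) ◁ (permTens (tailEquiv σ) (fun j => X (skip (σ 0) j)) ≫
        tensMap (fun i => eqToHom (congrArg X (skip_tailEquiv σ i)))))) =
      (extract (σ 0) (fun i => F.obj (X i)) ≫
      (F.obj (X (σ 0)) ◁ (permTens (tailEquiv σ) (fun j => F.obj (X (skip (σ 0) j))) ≫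
        tensMap (fun i => eqToHom (congrArg (fun i => F.obj (X i)) (skip_tailEquiv σ i)))))) ≫
      (F.obj (X (σ 0)) ◁ laxTens F (fun i => X (σ i.succ))) ≫ μ F _ _
    have he : (fun i => eqToHom (congrArg (fun i => F.obj (X i)) (skip_tailEquiv σ i))) =
      fun i => F.map (eqToHom (congrArg X (skip_tailEquiv σ i))) := by
      funext i; rw [eqToHom_map]
    rw [he, F.map_comp, reassoc_of% hx, ← μ_natural_right, Category.assoc,
      ← whiskerLeft_comp_assoc, ← whiskerLeft_comp_assoc, F.map_comp, reassoc_of% ih,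
      Category.assoc, laxTens_natural]

end Braided

end Tensor

/-! ### Diagrams with lax monoidal functors -/

section Aux

open Functor.LaxMonoidal

variable {C : Type u₁} [Category.{v₁} C] [MonoidalCategory C]
  {D : Type u₂} [Category.{v₂} D] [MonoidalCategory D]

lemma assoc_aux {X X' T T' B S S' S'' Y : C} (x : X ⟶ X') (t : T ⟶ T') {s' : T' ⊗ B ⟶ S'}
    {s : T ⊗ B ⟶ S} (r : S ⟶ S') (c : S' ⟶ S'') (h : (t ▷ B) ≫ s' = s ≫ r) (a : X' ⊗ S'' ⟶ Y) :
    ((x ⊗ₘ t) ▷ B) ≫ (α_ X' T' B).hom ≫ (X' ◁ (s' ≫ c)) ≫ a =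
      (α_ X T B).hom ≫ (X ◁ (s ≫ r ≫ c)) ≫ (x ▷ S'') ≫ a := by
  rw [← reassoc_of% h, whisker_exchange_assoc, MonoidalCategory.tensorHom_def]
  simp

lemma lax_assoc_aux (F : C ⥤ D) [F.LaxMonoidal] {a T₁ T₂ S U b Y : C} {T₁' T₂' S' : D}
    (x : T₁' ⟶ F.obj T₁) (y : T₂' ⟶ F.obj T₂) (s : T₁ ⊗ T₂ ⟶ S) (w : S ⟶ U)
    (s' : T₁' ⊗ T₂' ⟶ S') (w' : S' ⟶ F.obj U) (g : a ⊗ T₁ ⟶ b) (h : b ⊗ T₂ ⟶ Y) (k : a ⊗ U ⟶ Y)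
    (hs : (x ⊗ₘ y) ≫ μ F T₁ T₂ ≫ F.map (s ≫ w) = s' ≫ w')
    (ha : (g ▷ T₂) ≫ h = (α_ a T₁ T₂).hom ≫ (a ◁ (s ≫ w)) ≫ k) :
    (((F.obj a ◁ x) ≫ μ F a T₁ ≫ F.map g) ▷ T₂') ≫ (F.obj b ◁ y) ≫ μ F b T₂ ≫ F.map h =
      (α_ (F.obj a) T₁' T₂').hom ≫ (F.obj a ◁ (s' ≫ w')) ≫ μ F a U ≫ F.map k := by
  have h1 : (F.map g ▷ F.obj T₂) ≫ μ F b T₂ ≫ F.map h =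
      μ F (a ⊗ T₁) T₂ ≫ F.map ((α_ a T₁ T₂).hom ≫ (a ◁ (s ≫ w)) ≫ k) := by
    rw [← ha, μ_natural_left_assoc, F.map_comp]
  have h2 := associativity F a T₁ T₂
  rw [← whisker_exchange_assoc, comp_whiskerRight, comp_whiskerRight, Category.assoc,
    Category.assoc, h1, F.map_comp, F.map_comp, reassoc_of% h2, ← μ_natural_right_assoc, ← hs,
    ← whiskerLeft_comp_assoc, MonoidalCategory.tensorHom_def']
  simp

lemma lax_one_aux (F : C ⥤ D) [F.LaxMonoidal] {I X T Y : C} {T' : D} (e : 𝟙_ C ⟶ I) (o : X ⟶ T)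
    (o' : F.obj X ⟶ T') (t : T' ⟶ F.obj T) (g : I ⊗ T ⟶ Y) (y : X ⟶ Y)
    (h : (λ_ X).inv ≫ (e ⊗ₘ o) ≫ g = y) (h2 : o' ≫ t = F.map o) :
    (λ_ (F.obj X)).inv ≫ ((ε F ≫ F.map e) ⊗ₘ o') ≫ (F.obj I ◁ t) ≫ μ F I T ≫ F.map g =
      F.map y := by
  rw [← id_tensorHom, tensorHom_comp_tensorHom_assoc, h2, ← h, F.map_comp, F.map_comp,
    ← left_unitality_inv, Category.assoc, Category.assoc, Category.assoc, ← μ_natural_assoc,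
    ← tensorHom_id,
    tensorHom_comp_tensorHom_assoc]
  simp

lemma lax_one_aux' (F : C ⥤ D) [F.LaxMonoidal] {X T Y : C} {T' : D} (u : 𝟙_ C ⟶ T)
    (u' : 𝟙_ D ⟶ T') (t : T' ⟶ F.obj T) (g : X ⊗ T ⟶ Y) (y : X ⟶ Y)
    (h : (ρ_ X).inv ≫ (X ◁ u) ≫ g = y) (h2 : u' ≫ t = ε F ≫ F.map u) :
    (ρ_ (F.obj X)).inv ≫ (F.obj X ◁ u') ≫ (F.obj X ◁ t) ≫ μ F X T ≫ F.map g = F.map y := by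
  rw [← whiskerLeft_comp_assoc, h2, ← h, F.map_comp, F.map_comp, ← right_unitality_inv]
  simp

lemma lax_map_aux (F : C ⥤ D) [F.LaxMonoidal] {X T Y X' T' Y' : C} {S S' : D} (x : X ⟶ X')
    (t : T ⟶ T') (y : Y ⟶ Y') (g : X ⊗ T ⟶ Y) (g' : X' ⊗ T' ⟶ Y') (s : S ⟶ F.obj T)
    (s' : S' ⟶ F.obj T') (r : S ⟶ S') (h : g ≫ y = (x ⊗ₘ t) ≫ g')
    (h2 : r ≫ s' = s ≫ F.map t) :
    ((F.obj X ◁ s) ≫ μ F X T ≫ F.map g) ≫ F.map y =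
      (F.map x ⊗ₘ r) ≫ (F.obj X' ◁ s') ≫ μ F X' T' ≫ F.map g' := by
  rw [← id_tensorHom (F.obj X') s', tensorHom_comp_tensorHom_assoc, h2, Category.assoc,
    Category.assoc, ← F.map_comp, h, F.map_comp, ← μ_natural_assoc, ← id_tensorHom,
    tensorHom_comp_tensorHom_assoc]
  simp

lemma lax_unit_aux {G : C ⥤ C} [G.LaxMonoidal] (τ : 𝟭 C ⟶ G)
    [NatTrans.IsMonoidal τ] {X T Y : C} {S' : C} (g : X ⊗ T ⟶ Y)
    (s' : S' ⟶ G.obj T) (r : T ⟶ S') (h2 : r ≫ s' = τ.app T) :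
    g ≫ τ.app Y = (τ.app X ⊗ₘ r) ≫ (G.obj X ◁ s') ≫ μ G X T ≫ G.map g := by
  have h := NatTrans.IsMonoidal.tensor (τ := τ) X T
  have h' := τ.naturality g
  dsimp at h h'
  rw [Category.id_comp] at h
  rw [← id_tensorHom (G.obj X) s', tensorHom_comp_tensorHom_assoc, h2, h', h]
  simp

end Aux

/-! ### Operads and their algebras -/

section Operads

/-- The objects of the groupoid of symmetric groups in positive arities. -/
structure Arity where
  /-- the number of inputs -/
  n : ℕ
  pos : 0 < n

namespace Arity

instance : Category Arity where
  Hom l m := Fin l.n ≃ Fin m.n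
  id l := Equiv.refl (Fin l.n)
  comp f g := f.trans g

/-- The permutation underlying a morphism of arities. -/
def perm {l m : Arity} (σ : l ⟶ m) : Fin l.n ≃ Fin m.n := σ

/-- A bijection as a morphism of arities. -/
def ofPerm {l m : Arity} (σ : Fin l.n ≃ Fin m.n) : l ⟶ m := σ

/-- The arity `1`. -/
abbrev one : Arity := ⟨1, Nat.one_pos⟩

/-- The arity `m 0 + ⋯ + m (l - 1)`. -/
abbrev sum (l : Arity) (m : Fin l.n → Arity) : Arity :=
  ⟨tsum fun i => (m i).n, tsum_pos l.pos _ fun i => (m i).pos⟩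

/-- The sum `τ 0 ⊕ ⋯ ⊕ τ (l - 1)` of permutations. -/
def sumMap (l : Arity) {m m' : Fin l.n → Arity} (τ : ∀ i, m i ⟶ m' i) : sum l m ⟶ sum l m' :=
  ofPerm ((sigmaFin fun i => (m i).n).symm.trans
    ((Equiv.sigmaCongrRight fun i => perm (τ i)).trans (sigmaFin fun i => (m' i).n)))

/-- The block permutation: it moves the `i`-th block to the place of the `σ i`-th one. -/
def sumPerm {l l' : Arity} (σ : l ⟶ l') (m : Fin l'.n → Arity) :
    sum l (fun i => m (perm σ i)) ⟶ sum l' m :=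
  ofPerm ((sigmaFin fun i => (m (perm σ i)).n).symm.trans
    ((Equiv.sigmaCongrLeft (β := fun i => Fin (m i).n) (perm σ)).trans
      (sigmaFin fun i => (m i).n)))

/-- The order preserving bijection between an iterated sum and a sum. -/
def sumAssoc (l : Arity) (m : Fin l.n → Arity) (n : Fin (sum l m).n → Arity) :
    sum l (fun i => sum (m i) (fun j => n (idx (fun i => (m i).n) i j))) ⟶ sum (sum l m) n :=
  ofPerm (finCongr (tsum_idx (fun i => (m i).n) (fun x => (n x).n)))

/-- The order preserving bijection between a sum with one summand and its summand. -/
def sumOneLeft (m : Arity) : sum one (fun _ => m) ⟶ m :=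
  ofPerm (finCongr (Nat.zero_add m.n))

/-- The order preserving bijection between `1 + ⋯ + 1` and `l`. -/
def sumOneRight (l : Arity) : sum l (fun _ => one) ⟶ l :=
  ofPerm (finCongr (tsum_const_one l.n))

end Arity

open Arity

variable (C : Type u₁) [Category.{v₁} C] [MonoidalCategory C] [SymmetricCategory C]

/-- Symmetric operads (with arities `l ≥ 1`) in a symmetric monoidal category: a contravariant
functor on the groupoid of symmetric groups, that is, right actions of the symmetric groups, with
composition products and a unit. -/
structure Operad where
  /-- the underlying `Σ`-module -/
  mod : Arityᵒᵖ ⥤ C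
  /-- the composition products -/
  γ (l : Arity) (m : Fin l.n → Arity) :
    mod.obj (op l) ⊗ tens (fun i => mod.obj (op (m i))) ⟶ mod.obj (op (sum l m))
  /-- the unit -/
  η : 𝟙_ C ⟶ mod.obj (op one)
  γ_sumMap (l : Arity) (m m' : Fin l.n → Arity) (τ : ∀ i, m i ⟶ m' i) :
    (mod.obj (op l) ◁ tensMap (fun i => mod.map (τ i).op)) ≫ γ l m =
      γ l m' ≫ mod.map (sumMap l τ).op
  γ_sumPerm (l l' : Arity) (σ : l ⟶ l') (m : Fin l'.n → Arity) :
    (mod.map σ.op ⊗ₘ permTens (perm σ) (fun i => mod.obj (op (m i)))) ≫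
        γ l (fun i => m (perm σ i)) =
      γ l' m ≫ mod.map (sumPerm σ m).op
  assoc (l : Arity) (m : Fin l.n → Arity) (n : Fin (sum l m).n → Arity) :
    (γ l m ▷ tens (fun x => mod.obj (op (n x)))) ≫ γ (sum l m) n ≫
        mod.map (sumAssoc l m n).op =
      (α_ _ _ _).hom ≫ (mod.obj (op l) ◁
        (shuffle (fun i => (m i).n) (fun i => mod.obj (op (m i))) (fun x => mod.obj (op (n x))) ≫
          tensMap (fun i => γ (m i) (fun j => n (idx (fun i => (m i).n) i j))))) ≫
        γ l (fun i => sum (m i) (fun j => n (idx (fun i => (m i).n) i j)))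
  one_γ (m : Arity) :
    (λ_ (mod.obj (op m))).inv ≫ (η ⊗ₘ tensOne (mod.obj (op m))) ≫ γ one (fun _ => m) =
      mod.map (sumOneLeft m).op
  γ_one (l : Arity) :
    (ρ_ (mod.obj (op l))).inv ≫ (mod.obj (op l) ◁ (tensUnit l.n ≫ tensMap (fun _ => η))) ≫
      γ l (fun _ => one) = mod.map (sumOneRight l).op

namespace Operad

variable {C}

/-- The object `P(l)`. -/
abbrev obj (P : Operad C) (l : Arity) : C := P.mod.obj (op l)

/-- Morphisms of operads. -/
@[ext]
structure Hom (P Q : Operad C) where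
  /-- the underlying morphism of `Σ`-modules -/
  hom : P.mod ⟶ Q.mod
  γ_comm (l : Arity) (m : Fin l.n → Arity) :
    P.γ l m ≫ hom.app (op (sum l m)) =
      (hom.app (op l) ⊗ₘ tensMap (fun i => hom.app (op (m i)))) ≫ Q.γ l m
  η_comm : P.η ≫ hom.app (op one) = Q.η

instance : Category (Operad C) where
  Hom P Q := Hom P Q
  id P := ⟨𝟙 P.mod, fun l m => by simp, by simp⟩
  comp {P Q R} f g := ⟨f.hom ≫ g.hom, fun l m => by
      have h := tensMap_comp (fun i => f.hom.app (op (m i))) (fun i => g.hom.app (op (m i)))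
      simp only [NatTrans.comp_app] at h ⊢
      rw [reassoc_of% (f.γ_comm l m), g.γ_comm, tensorHom_comp_tensorHom_assoc, h],
    by rw [NatTrans.comp_app, reassoc_of% f.η_comm, g.η_comm]⟩

@[ext]
lemma hom_ext {P Q : Operad C} {f g : P ⟶ Q} (h : f.hom = g.hom) : f = g := Hom.ext h

@[simp]
lemma id_hom (P : Operad C) : Hom.hom (𝟙 P) = 𝟙 P.mod := rfl

@[simp]
lemma comp_hom {P Q R : Operad C} (f : P ⟶ Q) (g : Q ⟶ R) : (f ≫ g).hom = f.hom ≫ g.hom := rfl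

variable (C) in
/-- The underlying `Σ`-module. -/
@[simps]
def forget : Operad C ⥤ (Arityᵒᵖ ⥤ C) where
  obj P := P.mod
  map f := f.hom

end Operad

variable {C}

/-- Algebras over an operad. -/
structure Algebra (P : Operad C) where
  /-- the underlying object -/
  X : C
  /-- the structure morphisms -/
  act (l : Arity) : P.obj l ⊗ tens (fun _ : Fin l.n => X) ⟶ X
  act_perm (l l' : Arity) (σ : l ⟶ l') :
    (P.mod.map σ.op ⊗ₘ permTens (perm σ) (fun _ => X)) ≫ act l = act l'
  assoc (l : Arity) (m : Fin l.n → Arity) :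
    (P.γ l m ▷ tens (fun _ : Fin (sum l m).n => X)) ≫ act (sum l m) =
      (α_ _ _ _).hom ≫ (P.obj l ◁
        (shuffle (fun i => (m i).n) (fun i => P.obj (m i)) (fun _ => X) ≫
          tensMap (fun i => act (m i)))) ≫ act l
  one_act : (λ_ X).inv ≫ (P.η ⊗ₘ tensOne X) ≫ act one = 𝟙 X

namespace Algebra

/-- Morphisms of algebras over a fixed operad. -/
@[ext]
structure Hom {P : Operad C} (A B : Algebra P) where
  /-- the underlying morphism -/
  hom : A.X ⟶ B.X
  comm (l : Arity) : A.act l ≫ hom = (P.obj l ◁ tensMap (fun _ => hom)) ≫ B.act l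

instance (P : Operad C) : Category (Algebra P) where
  Hom A B := Hom A B
  id A := ⟨𝟙 A.X, fun l => by simp⟩
  comp {A B D} f g := ⟨f.hom ≫ g.hom, fun l => by
    rw [reassoc_of% (f.comm l), g.comm, tensMap_comp, whiskerLeft_comp_assoc]⟩

@[ext]
lemma hom_ext {P : Operad C} {A B : Algebra P} {f g : A ⟶ B} (h : f.hom = g.hom) : f = g :=
  Hom.ext h

@[simp]
lemma id_hom {P : Operad C} (A : Algebra P) : Hom.hom (𝟙 A) = 𝟙 A.X := rfl

@[simp]
lemma comp_hom {P : Operad C} {A B D : Algebra P} (f : A ⟶ B) (g : B ⟶ D) :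
    (f ≫ g).hom = f.hom ≫ g.hom := rfl

/-- The underlying object. -/
@[simps]
def forget (P : Operad C) : Algebra P ⥤ C where
  obj A := A.X
  map f := f.hom

/-- The inverse image `f^*B` of an algebra under a morphism of operads. -/
abbrev restrictObj {P Q : Operad C} (f : P ⟶ Q) (B : Algebra Q) : Algebra P where
  X := B.X
  act l := (f.hom.app (op l) ▷ tens (fun _ : Fin l.n => B.X)) ≫ B.act l
  act_perm l l' σ := by
    rw [← B.act_perm l l' σ, ← tensorHom_id, ← tensorHom_id, tensorHom_comp_tensorHom_assoc,
      tensorHom_comp_tensorHom_assoc, f.hom.naturality]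
    simp
  assoc l m := by
    rw [← comp_whiskerRight_assoc, f.γ_comm, comp_whiskerRight_assoc, B.assoc, tensMap_comp]
    exact assoc_aux _ _ _ _ (shuffle_natural _ _ _) _
  one_act := by
    have h := B.one_act
    rw [← f.η_comm] at h
    rw [← h, ← tensorHom_id, tensorHom_comp_tensorHom_assoc]
    simp

/-- The inverse image functor `f^*`. -/
@[simps]
def restrict {P Q : Operad C} (f : P ⟶ Q) : Algebra Q ⥤ Algebra P where
  obj := restrictObj f
  map {A B} φ := ⟨φ.hom, fun l => by
    change (_ ≫ A.act l) ≫ φ.hom = _ ≫ _ ≫ B.act l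
    rw [Category.assoc, φ.comm, whisker_exchange_assoc]⟩

end Algebra

variable (C) in
/-- Pairs `(P, A)` of an operad `P` and a `P`-algebra `A`. -/
structure OpAlg where
  /-- the operad -/
  operad : Operad C
  /-- the algebra -/
  alg : Algebra operad

namespace OpAlg

/-- Morphisms `(P, A) ⟶ (Q, B)`: a morphism of operads `f : P ⟶ Q` together with a morphism of
`P`-algebras `φ : A ⟶ f^*B`. -/
@[ext]
structure Hom (A B : OpAlg C) where
  /-- the morphism of operads -/
  f : A.operad ⟶ B.operad
  /-- the morphism of algebras -/
  φ : A.alg.X ⟶ B.alg.X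
  comm (l : Arity) :
    A.alg.act l ≫ φ = (f.hom.app (op l) ⊗ₘ tensMap (fun _ => φ)) ≫ B.alg.act l

instance : Category (OpAlg C) where
  Hom A B := Hom A B
  id A := ⟨𝟙 A.operad, 𝟙 A.alg.X, fun l => by simp⟩
  comp {A B D} p q := ⟨p.f ≫ q.f, p.φ ≫ q.φ, fun l => by
    rw [reassoc_of% (p.comm l), q.comm l, tensMap_comp, tensorHom_comp_tensorHom_assoc]
    rfl⟩

@[ext]
lemma hom_ext {A B : OpAlg C} {p q : A ⟶ B} (h : p.f = q.f) (h' : p.φ = q.φ) : p = q :=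
  Hom.ext h h'

@[simp]
lemma comp_f {A B D : OpAlg C} (p : A ⟶ B) (q : B ⟶ D) : (p ≫ q).f = p.f ≫ q.f := rfl

@[simp]
lemma comp_φ {A B D : OpAlg C} (p : A ⟶ B) (q : B ⟶ D) : (p ≫ q).φ = p.φ ≫ q.φ := rfl

variable (C) in
/-- The underlying operad. -/
@[simps]
def operadFunctor : OpAlg C ⥤ Operad C where
  obj A := A.operad
  map p := Hom.f p

variable (C) in
/-- The underlying object of the algebra. -/
@[simps]
def algFunctor : OpAlg C ⥤ C where
  obj A := A.alg.X
  map p := Hom.φ p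

end OpAlg

/-! #### Images under symmetric monoidal functors -/

section Functoriality

open Functor.LaxMonoidal

variable {D : Type u₂} [Category.{v₂} D] [MonoidalCategory D] [SymmetricCategory D]

namespace Operad

/-- The operad `F(P)` with `F(P)(l) = F(P(l))`. -/
abbrev mapObj (F : C ⥤ D) [F.LaxBraided] (P : Operad C) : Operad D where
  mod := P.mod ⋙ F
  γ l m := (F.obj (P.obj l) ◁ laxTens F (fun i => P.obj (m i))) ≫ μ F _ _ ≫ F.map (P.γ l m)
  η := ε F ≫ F.map P.η
  γ_sumMap l m m' τ := by
    dsimp only [Functor.comp_obj, Functor.comp_map]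
    have h := laxTens_natural F (fun i => P.mod.map (τ i).op)
    rw [← whiskerLeft_comp_assoc, h, whiskerLeft_comp_assoc, μ_natural_right_assoc,
      ← F.map_comp, P.γ_sumMap]
    simp
  γ_sumPerm l l' σ m := by
    dsimp only [Functor.comp_obj, Functor.comp_map]
    have h := laxTens_perm F (perm σ) (fun i => P.obj (m i))
    have h2 := P.γ_sumPerm l l' σ m
    rw [← id_tensorHom, tensorHom_comp_tensorHom_assoc, ← h, Category.assoc, Category.assoc,
      ← F.map_comp, ← h2, ← id_tensorHom, F.map_comp, ← μ_natural_assoc,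
      tensorHom_comp_tensorHom_assoc]
    simp
  assoc l m n := by
    have h := laxTens_shuffle F (fun i => (m i).n) (fun i => P.obj (m i)) (fun x => P.obj (n x))
    have h2 := laxTens_natural F (fun i => P.γ (m i) (fun j => n (idx (fun i => (m i).n) i j)))
    have h3 := tensMap_comp (fun i => (F.obj (P.obj (m i)) ◁
      laxTens F (fun j => P.obj (n (idx (fun i => (m i).n) i j)))) ≫ μ F _ _)
      (fun i => F.map (P.γ (m i) (fun j => n (idx (fun i => (m i).n) i j))))
    have h4 := lax_assoc_aux F (laxTens F (fun i => P.obj (m i))) (laxTens F (fun x => P.obj (n x)))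
      (shuffle (fun i => (m i).n) (fun i => P.obj (m i)) (fun x => P.obj (n x)))
      (tensMap fun i => P.γ (m i) (fun j => n (idx (fun i => (m i).n) i j)))
      (shuffle (fun i => (m i).n) (fun i => F.obj (P.obj (m i))) (fun x => F.obj (P.obj (n x))))
      (tensMap (fun i => ((F.obj (P.obj (m i)) ◁
        laxTens F (fun j => P.obj (n (idx (fun i => (m i).n) i j)))) ≫ μ F _ _) ≫
          F.map (P.γ (m i) (fun j => n (idx (fun i => (m i).n) i j)))) ≫ laxTens F _)
      (P.γ l m) (P.γ (sum l m) n ≫ P.mod.map (sumAssoc l m n).op) (P.γ l _) (by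
        rw [F.map_comp, reassoc_of% h, ← h2, h3]
        simp only [Category.assoc]) (P.assoc l m n)
    simp only [Category.assoc, F.map_comp, whiskerLeft_comp] at h4 ⊢
    exact h4
  one_γ m := by
    have h := P.one_γ m
    have h2 := laxTens_one F (P.obj m)
    exact lax_one_aux F _ _ _ _ _ _ h h2
  γ_one l := by
    have h := laxTens_natural F (fun _ : Fin l.n => P.η)
    have h2 := laxTens_unit F l.n
    have h3 := tensMap_comp (fun _ : Fin l.n => ε F) (fun _ : Fin l.n => F.map P.η)
    refine lax_one_aux' F _ _ _ _ _ (P.γ_one l) ?_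
    rw [h3, Category.assoc, Category.assoc, h, reassoc_of% h2, ← F.map_comp]

/-- The functor `P ↦ F(P)`. -/
abbrev map (F : C ⥤ D) [F.LaxBraided] : Operad C ⥤ Operad D where
  obj := mapObj F
  map {P Q} f := ⟨Functor.whiskerRight f.hom F, fun l m =>
    lax_map_aux F _ _ _ _ _ _ _ _ (f.γ_comm l m)
      (laxTens_natural F (fun i => f.hom.app (op (m i)))), by
    change (ε F ≫ F.map P.η) ≫ F.map (f.hom.app (op one)) = ε F ≫ F.map Q.η
    rw [Category.assoc, ← F.map_comp, f.η_comm]⟩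
  map_id P := Operad.hom_ext (Functor.whiskerRight_id' F)
  map_comp f g := Operad.hom_ext (Functor.whiskerRight_comp f.hom g.hom F)

/-- The morphism `P ⟶ G(P)` given by a monoidal transformation `𝟭 ⟶ G`. -/
def unitNat {G : C ⥤ C} [G.LaxBraided] (τ : 𝟭 C ⟶ G) [NatTrans.IsMonoidal τ] :
    𝟭 (Operad C) ⟶ Operad.map G where
  app P := ⟨Functor.whiskerLeft P.mod τ, fun l m =>
    lax_unit_aux τ _ _ _ (laxTens_app_id τ (fun i => P.obj (m i))), by
    have h := NatTrans.IsMonoidal.unit (τ := τ)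
    have h' := τ.naturality P.η
    change 𝟙 _ ≫ τ.app _ = _ at h
    rw [Category.id_comp] at h
    change P.η ≫ τ.app _ = ε G ≫ G.map P.η
    rw [← h]
    exact h'⟩
  naturality P Q f := Operad.hom_ext (NatTrans.ext (funext fun l => τ.naturality (f.hom.app l)))

end Operad

namespace Algebra

/-- The `F(P)`-algebra `F(A)`. -/
abbrev mapObj (F : C ⥤ D) [F.LaxBraided] {P : Operad C} (A : Algebra P) :
    Algebra (Operad.mapObj F P) where
  X := F.obj A.X
  act l := (F.obj (P.obj l) ◁ laxTens F (fun _ => A.X)) ≫ μ F _ _ ≫ F.map (A.act l)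
  act_perm l l' σ := by
    have h := laxTens_perm F (perm σ) (fun _ => A.X)
    have h2 := A.act_perm l l' σ
    dsimp only [Functor.comp_obj, Functor.comp_map]
    rw [← id_tensorHom, tensorHom_comp_tensorHom_assoc, ← h, ← h2, F.map_comp, ← μ_natural_assoc,
      ← id_tensorHom, tensorHom_comp_tensorHom_assoc]
    simp
  assoc l m := by
    have h := laxTens_shuffle F (fun i => (m i).n) (fun i => P.obj (m i)) (fun _ => A.X)
    have h2 := laxTens_natural F (fun i => A.act (m i))
    have h3 := tensMap_comp (fun i => (F.obj (P.obj (m i)) ◁ laxTens F (fun _ => A.X)) ≫ μ F _ _)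
      (fun i => F.map (A.act (m i)))
    have h4 := lax_assoc_aux F (laxTens F (fun i => P.obj (m i))) (laxTens F (fun _ => A.X))
      (shuffle (fun i => (m i).n) (fun i => P.obj (m i)) (fun _ => A.X))
      (tensMap fun i => A.act (m i))
      (shuffle (fun i => (m i).n) (fun i => F.obj (P.obj (m i))) (fun _ => F.obj A.X))
      (tensMap (fun i => ((F.obj (P.obj (m i)) ◁ laxTens F (fun _ => A.X)) ≫ μ F _ _) ≫
          F.map (A.act (m i))) ≫ laxTens F _)
      (P.γ l m) (A.act (sum l m)) (A.act l) (by
        rw [F.map_comp, reassoc_of% h, ← h2, h3]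
        simp only [Category.assoc]) (A.assoc l m)
    simp only [Category.assoc, whiskerLeft_comp] at h4 ⊢
    exact h4
  one_act :=
    (lax_one_aux F _ _ _ _ _ _ A.one_act (laxTens_one F A.X)).trans (F.map_id _)

/-- The functor `A ↦ F(A)` from `P`-algebras to `F(P)`-algebras. -/
abbrev map (F : C ⥤ D) [F.LaxBraided] (P : Operad C) :
    Algebra P ⥤ Algebra ((Operad.map F).obj P) where
  obj := mapObj F
  map {A B} φ := ⟨F.map φ.hom, fun l => by
    have h := lax_map_aux F (𝟙 (P.obj l)) (tensMap fun _ => φ.hom) φ.hom (A.act l) (B.act l)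
      (laxTens F fun _ => A.X) (laxTens F fun _ => B.X) (tensMap fun _ => F.map φ.hom)
      (by rw [φ.comm, id_tensorHom]) (laxTens_natural F (fun _ => φ.hom))
    rw [F.map_id, id_tensorHom] at h
    exact h⟩
  map_id A := hom_ext (F.map_id A.X)
  map_comp f g := hom_ext (F.map_comp f.hom g.hom)

/-- The morphism of `P`-algebras `A ⟶ τ^*G(A)` given by a monoidal transformation `𝟭 ⟶ G`. -/
def unitNat {G : C ⥤ C} [G.LaxBraided] (τ : 𝟭 C ⟶ G) [NatTrans.IsMonoidal τ] (P : Operad C) :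
    𝟭 (Algebra P) ⟶ Algebra.map G P ⋙ restrict ((Operad.unitNat τ).app P) where
  app A := ⟨τ.app A.X, fun l => by
    have h := lax_unit_aux τ (A.act l) _ _ (laxTens_app_id τ (fun _ : Fin l.n => A.X))
    rw [MonoidalCategory.tensorHom_def', Category.assoc] at h
    exact h⟩
  naturality A B f := hom_ext (τ.naturality f.hom)

end Algebra

namespace OpAlg

/-- The functor `(P, A) ↦ (F(P), F(A))`. -/
abbrev map (F : C ⥤ D) [F.LaxBraided] : OpAlg C ⥤ OpAlg D where
  obj A := ⟨(Operad.map F).obj A.operad, (Algebra.map F A.operad).obj A.alg⟩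
  map {A B} p := ⟨(Operad.map F).map p.f, F.map p.φ, fun l =>
    lax_map_aux F _ _ _ _ _ _ _ _ (p.comm l) (laxTens_natural F (fun _ => p.φ))⟩
  map_id A := hom_ext ((Operad.map F).map_id A.operad) (F.map_id A.alg.X)
  map_comp p q := hom_ext ((Operad.map F).map_comp p.f q.f) (F.map_comp p.φ q.φ)

/-- The morphism `(P, A) ⟶ (G(P), G(A))` given by a monoidal transformation `𝟭 ⟶ G`. -/
def unitNat {G : C ⥤ C} [G.LaxBraided] (τ : 𝟭 C ⟶ G) [NatTrans.IsMonoidal τ] :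
    𝟭 (OpAlg C) ⟶ OpAlg.map G where
  app A := ⟨(Operad.unitNat τ).app A.operad, τ.app A.alg.X, fun l =>
    lax_unit_aux τ (A.alg.act l) _ _ (laxTens_app_id τ (fun _ : Fin l.n => A.alg.X))⟩
  naturality A B p := hom_ext ((Operad.unitNat τ).naturality p.f) (τ.naturality p.φ)

end OpAlg

end Functoriality

end Operads

/-! ### The cosimplicial resolution given by a monad -/

section Resolution

/-- For a monotone map without the value `0`, the map shifted down by one. -/
def predHom {m n : ℕ} (f : Fin m →o Fin (n + 1)) (h : ∀ i, f i ≠ 0) : Fin m →o Fin n where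
  toFun i := (f i).pred (h i)
  monotone' _ _ hij := Fin.pred_le_pred_iff.2 (f.monotone hij)

/-- The restriction of a monotone map to the non-zero elements. -/
def tailHom {m n : ℕ} (f : Fin (m + 1) →o Fin n) : Fin m →o Fin n where
  toFun i := f i.succ
  monotone' _ _ hij := f.monotone (Fin.succ_le_succ_iff.2 hij)

lemma ne_zero_of_zero {m n : ℕ} (f : Fin (m + 1) →o Fin (n + 1)) (h : f 0 ≠ 0) (i : Fin (m + 1)) :
    f i ≠ 0 :=
  fun hi => h (le_antisymm (hi ▸ f.monotone (Fin.zero_le i)) (Fin.zero_le _))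

variable {A : Type u₁} [Category.{v₁} A] (T : Monad A)

/-- The transformation `K ⟶ T ∘ K` given by the unit. -/
def unitOut (K : A ⥤ A) : K ⟶ K ⋙ T.toFunctor :=
  (Functor.rightUnitor K).inv ≫ Functor.whiskerLeft K T.η

/-- The transformation `T ∘ K ⟶ T ∘ L` which extends `α : K ⟶ T ∘ L` by the multiplication. -/
def extOut {K L : A ⥤ A} (α : K ⟶ L ⋙ T.toFunctor) : K ⋙ T.toFunctor ⟶ L ⋙ T.toFunctor :=
  Functor.whiskerRight α T.toFunctor ≫ (Functor.associator L T.toFunctor T.toFunctor).hom ≫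
    Functor.whiskerLeft L T.μ

lemma unitOut_extOut {K L : A ⥤ A} (α : K ⟶ L ⋙ T.toFunctor) : unitOut T K ≫ extOut T α = α := by
  ext X
  have h := T.η.naturality (α.app X)
  have h2 := T.left_unit (L.obj X)
  dsimp at h
  simp [unitOut, extOut, ← reassoc_of% h, h2]

lemma extOut_unitOut (K : A ⥤ A) : extOut T (unitOut T K) = 𝟙 (K ⋙ T.toFunctor) := by
  ext X
  have h2 := T.right_unit (K.obj X)
  simp [unitOut, extOut, h2]

lemma extOut_comp {K L M : A ⥤ A} (α : K ⟶ L ⋙ T.toFunctor) (β : L ⟶ M ⋙ T.toFunctor) :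
    extOut T (α ≫ extOut T β) = extOut T α ≫ extOut T β := by
  ext X
  have h := T.μ.naturality (β.app X)
  have h2 := T.assoc (M.obj X)
  dsimp at h
  simp [extOut, ← reassoc_of% h, h2]

/-- The iterated composite `T ∘ ⋯ ∘ T`. -/
@[reducible]
def iter : ℕ → (A ⥤ A)
  | 0 => 𝟭 A
  | n + 1 => iter n ⋙ T.toFunctor

/-- The transformation `T^m ⟶ T^n` which belongs to a monotone map `Fin m → Fin n`: the factors
over one element are multiplied with each other, and units are inserted at the elements that are
not in the image. -/
def iterMap : (m n : ℕ) → (Fin m →o Fin n) → (iter T m ⟶ iter T n)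
  | 0, 0, _ => 𝟙 (iter T 0)
  | 0, n + 1, _ => iterMap 0 n ⟨Fin.elim0, fun i => i.elim0⟩ ≫ unitOut T (iter T n)
  | _ + 1, 0, f => (f 0).elim0
  | m + 1, n + 1, f =>
      if h : f 0 = 0 then
        extOut T (iterMap m (n + 1) (tailHom f))
      else iterMap (m + 1) n (predHom f (ne_zero_of_zero f h)) ≫ unitOut T (iter T n)
termination_by m n => m + n

lemma iterMap_of_ne_zero (m n : ℕ) (f : Fin m →o Fin (n + 1)) (h : ∀ i, f i ≠ 0) :
    iterMap T m (n + 1) f = iterMap T m n (predHom f h) ≫ unitOut T (iter T n) := by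
  cases m with
  | zero =>
    rw [iterMap]
    congr 2
    ext i
    exact i.elim0
  | succ m => rw [iterMap, dif_neg (h 0)]

lemma iterMap_of_zero (m n : ℕ) (f : Fin (m + 1) →o Fin (n + 1)) (h : f 0 = 0) :
    iterMap T (m + 1) (n + 1) f = extOut T (iterMap T m (n + 1) (tailHom f)) := by
  rw [iterMap]
  exact dif_pos h

lemma iterMap_id (n : ℕ) : iterMap T n n OrderHom.id = 𝟙 (iter T n) := by
  induction n with
  | zero => rw [iterMap]
  | succ n ih =>
    rw [iterMap_of_zero T n n _ rfl, iterMap_of_ne_zero T n n _ (fun i => Fin.succ_ne_zero i)]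
    have : predHom (tailHom (OrderHom.id : Fin (n + 1) →o Fin (n + 1)))
      (fun i => Fin.succ_ne_zero i) = OrderHom.id := by
      ext i
      rfl
    rw [this, ih, Category.id_comp, extOut_unitOut]

lemma iterMap_comp : (m n p : ℕ) → (f : Fin m →o Fin n) → (g : Fin n →o Fin p) →
    iterMap T m p (g.comp f) = iterMap T m n f ≫ iterMap T n p g
  | m, n, 0, f, g => by
    obtain rfl : n = 0 := by
      by_contra h
      exact (g ⟨0, Nat.pos_of_ne_zero h⟩).elim0
    obtain rfl : m = 0 := by
      by_contra h
      exact (f ⟨0, Nat.pos_of_ne_zero h⟩).elim0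
    simp [iterMap]
  | m, n, p + 1, f, g => by
    by_cases hg : ∀ i, g i ≠ 0
    · rw [iterMap_of_ne_zero T n p g hg, iterMap_of_ne_zero T m p (g.comp f) fun i => hg (f i),
        ← Category.assoc, ← iterMap_comp m n p]
      rfl
    · cases n with
      | zero => exact (hg fun i => i.elim0).elim
      | succ n =>
        have hg0 : g 0 = 0 := by
          by_contra h
          exact hg (ne_zero_of_zero g h)
        by_cases hf : ∀ i, f i ≠ 0
        · rw [iterMap_of_ne_zero T m n f hf, iterMap_of_zero T n p g hg0, Category.assoc,
            unitOut_extOut, ← iterMap_comp m n (p + 1)]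
          congr 1
          ext i
          change (g (f i)).1 = (g ((f i).pred (hf i)).succ).1
          rw [Fin.succ_pred]
        · cases m with
          | zero => exact (hf fun i => i.elim0).elim
          | succ m =>
            have hf0 : f 0 = 0 := by
              by_contra h
              exact hf (ne_zero_of_zero f h)
            rw [iterMap_of_zero T m n f hf0, iterMap_of_zero T m p (g.comp f) (by simp [hf0, hg0]),
              iterMap_of_zero T n p g hg0, ← extOut_comp, ← iterMap_of_zero T n p g hg0,
              ← iterMap_comp m (n + 1) (p + 1)]
            rfl
termination_by m n p => m + n + p

end Resolution

/-! ### Lax symmetric monoidal functors between categories of diagrams -/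

section LaxFunctors

open Functor.LaxMonoidal

variable {A : Type u₁} [Category.{v₁} A] [MonoidalCategory A] [BraidedCategory A]
  {B : Type u₂} [Category.{v₂} B] [MonoidalCategory B] [BraidedCategory B]
  {I : Type u₃} [Category.{v₃} I] {I' : Type u} [Category.{v} I']

instance evaluationLaxBraided (i : I) : ((evaluation I A).obj i).LaxBraided where
  ε := 𝟙 (𝟙_ A)
  μ X Y := 𝟙 (X.obj i ⊗ Y.obj i)
  μ_natural_left _ _ := (Category.comp_id _).trans (Category.id_comp _).symm
  μ_natural_right _ _ := (Category.comp_id _).trans (Category.id_comp _).symm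
  associativity X Y Z := by
    change (𝟙 (X.obj i ⊗ Y.obj i) ▷ Z.obj i) ≫ 𝟙 _ ≫ (α_ (X.obj i) (Y.obj i) (Z.obj i)).hom =
      (α_ (X.obj i) (Y.obj i) (Z.obj i)).hom ≫ (X.obj i ◁ 𝟙 (Y.obj i ⊗ Z.obj i)) ≫ 𝟙 _
    simp
  left_unitality X := by
    change (λ_ (X.obj i)).hom = (𝟙 (𝟙_ A) ▷ X.obj i) ≫ 𝟙 _ ≫ (λ_ (X.obj i)).hom
    simp
  right_unitality X := by
    change (ρ_ (X.obj i)).hom = (X.obj i ◁ 𝟙 (𝟙_ A)) ≫ 𝟙 _ ≫ (ρ_ (X.obj i)).hom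
    simp
  braided _ _ := (Category.id_comp _).trans (Category.comp_id _).symm

instance {i j : I} (f : i ⟶ j) : NatTrans.IsMonoidal ((evaluation I A).map f) where
  unit := Category.id_comp _
  tensor _ _ := (Category.id_comp _).trans (Category.comp_id _).symm

/-- The functor given by a diagram of lax symmetric monoidal functors and monoidal
transformations. -/
instance flipLaxBraided (K : I ⥤ A ⥤ B) [∀ i, (K.obj i).LaxBraided]
    [∀ {i j : I} (f : i ⟶ j), NatTrans.IsMonoidal (K.map f)] : K.flip.LaxBraided where
  ε := { app i := ε (K.obj i)
         naturality _ _ f := (Category.id_comp _).trans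
          (NatTrans.IsMonoidal.unit (τ := K.map f)).symm }
  μ X Y := { app i := μ (K.obj i) X Y
             naturality _ _ f := (NatTrans.IsMonoidal.tensor (τ := K.map f) X Y).symm }
  μ_natural_left f X := NatTrans.ext (funext fun i => μ_natural_left (K.obj i) f X)
  μ_natural_right X f := NatTrans.ext (funext fun i => μ_natural_right (K.obj i) X f)
  associativity X Y Z := NatTrans.ext (funext fun i => associativity (K.obj i) X Y Z)
  left_unitality X := NatTrans.ext (funext fun i => left_unitality (K.obj i) X)
  right_unitality X := NatTrans.ext (funext fun i => right_unitality (K.obj i) X)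
  braided X Y := NatTrans.ext (funext fun i => Functor.LaxBraided.braided (F := K.obj i) X Y)

lemma flip_isMonoidal {K L : I ⥤ A ⥤ B} [∀ i, (K.obj i).LaxBraided] [∀ i, (L.obj i).LaxBraided]
    [∀ {i j : I} (f : i ⟶ j), NatTrans.IsMonoidal (K.map f)]
    [∀ {i j : I} (f : i ⟶ j), NatTrans.IsMonoidal (L.map f)] (τ : K ⟶ L)
    [∀ i, NatTrans.IsMonoidal (τ.app i)] :
    NatTrans.IsMonoidal (show K.flip ⟶ L.flip from (flipFunctor I A B).map τ) where
  unit := NatTrans.ext (funext fun i => NatTrans.IsMonoidal.unit (τ := τ.app i))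
  tensor X Y := NatTrans.ext (funext fun i => NatTrans.IsMonoidal.tensor (τ := τ.app i) X Y)

instance constLaxBraided : (Functor.const I : A ⥤ I ⥤ A).LaxBraided :=
  letI (i : I) : (((Functor.const I).obj (𝟭 A)).obj i).LaxBraided :=
    inferInstanceAs (𝟭 A).LaxBraided
  have {i j : I} (f : i ⟶ j) : NatTrans.IsMonoidal (((Functor.const I).obj (𝟭 A)).map f) :=
    inferInstanceAs (NatTrans.IsMonoidal (𝟙 (𝟭 A)))
  inferInstanceAs ((Functor.const I).obj (𝟭 A)).flip.LaxBraided

instance whiskeringLeftLaxBraided (G : I' ⥤ I) :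
    ((Functor.whiskeringLeft I' I A).obj G).LaxBraided :=
  letI (i : I') : ((G ⋙ evaluation I A).obj i).LaxBraided :=
    inferInstanceAs ((evaluation I A).obj (G.obj i)).LaxBraided
  have {i j : I'} (f : i ⟶ j) : NatTrans.IsMonoidal ((G ⋙ evaluation I A).map f) :=
    inferInstanceAs (NatTrans.IsMonoidal ((evaluation I A).map (G.map f)))
  inferInstanceAs (G ⋙ evaluation I A).flip.LaxBraided

instance whiskeringRightLaxBraided (L : A ⥤ B) [L.LaxBraided] :
    ((Functor.whiskeringRight I A B).obj L).LaxBraided :=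
  letI (i : I) : ((evaluation I A ⋙ (Functor.whiskeringRight _ A B).obj L).obj i).LaxBraided :=
    inferInstanceAs ((evaluation I A).obj i ⋙ L).LaxBraided
  have {i j : I} (f : i ⟶ j) :
      NatTrans.IsMonoidal ((evaluation I A ⋙ (Functor.whiskeringRight _ A B).obj L).map f) :=
    inferInstanceAs (NatTrans.IsMonoidal (Functor.whiskerRight ((evaluation I A).map f) L))
  inferInstanceAs (evaluation I A ⋙ (Functor.whiskeringRight _ A B).obj L).flip.LaxBraided

variable (A I) in
/-- The evaluations of a diagram in two variables at the diagonal. -/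
def diagonalEval : I ⥤ (I ⥤ I ⥤ A) ⥤ A where
  obj i := (evaluation I (I ⥤ A)).obj i ⋙ (evaluation I A).obj i
  map f := (evaluation I (I ⥤ A)).map f ◫ (evaluation I A).map f

instance (i : I) : ((diagonalEval A I).obj i).LaxBraided :=
  inferInstanceAs ((evaluation I (I ⥤ A)).obj i ⋙ (evaluation I A).obj i).LaxBraided

instance {i j : I} (f : i ⟶ j) : NatTrans.IsMonoidal ((diagonalEval A I).map f) :=
  inferInstanceAs (NatTrans.IsMonoidal ((evaluation I (I ⥤ A)).map f ◫ (evaluation I A).map f))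

variable (A I) in
/-- The diagonal `i ↦ F i i` of a diagram in two variables. -/
abbrev diagonal : (I ⥤ I ⥤ A) ⥤ (I ⥤ A) := (diagonalEval A I).flip

end LaxFunctors

section ResolutionLax

variable {A : Type u₁} [Category.{v₁} A] [MonoidalCategory A] [BraidedCategory A] (T : Monad A)

instance iterLaxBraided [T.toFunctor.LaxBraided] : (n : ℕ) → (iter T n).LaxBraided
  | 0 => inferInstanceAs (𝟭 A).LaxBraided
  | n + 1 =>
    have := iterLaxBraided n
    inferInstanceAs (iter T n ⋙ T.toFunctor).LaxBraided

variable [T.toFunctor.LaxBraided] [NatTrans.IsMonoidal T.η] [NatTrans.IsMonoidal T.μ]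

instance (K : A ⥤ A) [K.LaxBraided] : NatTrans.IsMonoidal (unitOut T K) :=
  inferInstanceAs (NatTrans.IsMonoidal (_ ≫ _))

instance {K L : A ⥤ A} [K.LaxBraided] [L.LaxBraided] (α : K ⟶ L ⋙ T.toFunctor)
    [NatTrans.IsMonoidal α] : NatTrans.IsMonoidal (extOut T α) :=
  inferInstanceAs (NatTrans.IsMonoidal (_ ≫ _ ≫ _))

instance iterMap_isMonoidal : (m n : ℕ) → (f : Fin m →o Fin n) →
    NatTrans.IsMonoidal (iterMap T m n f)
  | 0, 0, f => by
    rw [iterMap]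
    infer_instance
  | 0, n + 1, f => by
    rw [iterMap]
    have := iterMap_isMonoidal 0 n ⟨Fin.elim0, fun i => i.elim0⟩
    exact NatTrans.IsMonoidal.comp _ (unitOut T (iter T n))
  | _ + 1, 0, f => (f 0).elim0
  | m + 1, n + 1, f => by
    by_cases h : f 0 = 0
    · rw [iterMap_of_zero T m n f h]
      have := iterMap_isMonoidal m (n + 1) (tailHom f)
      infer_instance
    · rw [iterMap_of_ne_zero T (m + 1) n f (ne_zero_of_zero f h)]
      have := iterMap_isMonoidal (m + 1) n (predHom f (ne_zero_of_zero f h))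
      exact NatTrans.IsMonoidal.comp _ (unitOut T (iter T n))
termination_by m n => m + n

end ResolutionLax

/-! ### Descent categories -/

section Descent

variable {D : Type u₁} [Category.{v₁} D]

section Power

variable [HasFiniteProducts D]

/-- The cosimplicial object `A^{Δ[1]}`, which is the product of copies of `A` over all maps
`[n] ⟶ [1]` in degree `n`. -/
@[simps]
def pathObject (A : D) : SimplexCategory ⥤ D where
  obj n := ∏ᶜ fun _ : (n ⟶ SimplexCategory.mk 1) => A
  map f := Pi.lift fun g => Pi.π _ (f ≫ g)

/-- The map `A^{Δ[1]} ⟶ A^{Δ[0]} = A` which is induced by the vertex `1` of `Δ[1]`. -/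
def pathEval (A : D) : pathObject A ⟶ (Functor.const SimplexCategory).obj A where
  app n := Pi.π (fun _ : (n ⟶ SimplexCategory.mk 1) => A)
    (SimplexCategory.const n (SimplexCategory.mk 1) 1)
  naturality n m f := by
    have h : f ≫ SimplexCategory.const m (SimplexCategory.mk 1) 1 =
      SimplexCategory.const n (SimplexCategory.mk 1) 1 := rfl
    rw [← h]
    exact (limit.lift_π _ _).trans (Category.comp_id _).symm

end Power

variable (E : MorphismProperty D)

/-- A class of morphisms is saturated if it consists of all morphisms that become invertible in its
localization. -/
def IsSaturated : Prop := ∀ ⦃X Y : D⦄ (f : X ⟶ Y), IsIso (E.Q.map f) → E f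

variable [HasFiniteProducts D]

/-- The diagonal of a diagram that is constant in the first variable. -/
def diagonalConst (X : SimplexCategory ⥤ D) :
    (diagonal D SimplexCategory).obj ((Functor.const SimplexCategory).obj X) ≅ X :=
  NatIso.ofComponents (fun n => Iso.refl (X.obj n)) fun f => by
    simp [diagonalEval]

/-- The diagonal of a diagram that is constant in the second variable. -/
def diagonalConst' (X : SimplexCategory ⥤ D) :
    (diagonal D SimplexCategory).obj (X ⋙ Functor.const SimplexCategory) ≅ X :=
  NatIso.ofComponents (fun n => Iso.refl (X.obj n)) fun f => by
    simp [diagonalEval]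

/-- The data and the axioms of a (cosimplicial) descent category with equivalences `E`. -/
structure DescentStructure where
  /-- the simple functor -/
  s : (SimplexCategory ⥤ D) ⥤ D
  /-- the transformation from the iterated simple to the simple of the diagonal -/
  μ : (Functor.whiskeringRight SimplexCategory (SimplexCategory ⥤ D) D).obj s ⋙ s ⟶
    diagonal D SimplexCategory ⋙ s
  /-- the transformation from an object to the simple of its constant cosimplicial object -/
  lam : 𝟭 D ⟶ Functor.const SimplexCategory ⋙ s
  saturated : IsSaturated E
  prod_map {X X' Y Y' : D} (f : X ⟶ X') (g : Y ⟶ Y') (hf : E f) (hg : E g) : E (prod.map f g)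
  exact {X Y : SimplexCategory ⥤ D} (f : X ⟶ Y) (hf : ∀ n, E (f.app n)) : E (s.map f)
  additive (X Y : SimplexCategory ⥤ D) : E (prodComparison s X Y)
  additive_terminal : E (terminal.from (s.obj (⊤_ (SimplexCategory ⥤ D))))
  μ_mem (Z : SimplexCategory ⥤ SimplexCategory ⥤ D) : E (μ.app Z)
  lam_mem (A : D) : E (lam.app A)
  lam_μ (X : SimplexCategory ⥤ D) :
    E.Q.map (lam.app (s.obj X)) ≫ E.Q.map (s.map (Functor.constComp SimplexCategory X s).inv) ≫
      E.Q.map (μ.app ((Functor.const SimplexCategory).obj X)) ≫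
        E.Q.map (s.map (diagonalConst X).hom) = 𝟙 (E.Q.obj (s.obj X))
  map_lam_μ (X : SimplexCategory ⥤ D) :
    E.Q.map (s.map (Functor.whiskerLeft X lam)) ≫
      E.Q.map (μ.app (X ⋙ Functor.const SimplexCategory)) ≫
        E.Q.map (s.map (diagonalConst' X).hom) = 𝟙 (E.Q.obj (s.obj X))
  path (A : D) : E (s.map (pathEval A))

/-- A monoidal descent structure: the simple functor is a lax symmetric monoidal functor and `μ`,
`λ` are monoidal transformations. -/
structure MonoidalDescentStructure [MonoidalCategory D] [SymmetricCategory D] extends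
    DescentStructure E where
  laxBraided : s.LaxBraided
  μ_isMonoidal : NatTrans.IsMonoidal μ
  lam_isMonoidal : NatTrans.IsMonoidal lam

end Descent

/-! ### The hypercohomology presheaf of a monad -/

section Hyper

/-- The cosimplicial functor `[n] ↦ T^(n + 1)` given by a monad. -/
def resolution {A : Type u₁} [Category.{v₁} A] (T : Monad A) : SimplexCategory ⥤ A ⥤ A where
  obj n := iter T (n.len + 1)
  map f := iterMap T _ _ f.toOrderHom
  map_id n := iterMap_id T (n.len + 1)
  map_comp f g := iterMap_comp T _ _ _ f.toOrderHom g.toOrderHom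

/-- The augmentation of the cosimplicial functor `[n] ↦ T^(n + 1)`. -/
def augmentation {A : Type u₁} [Category.{v₁} A] (T : Monad A) :
    (Functor.const SimplexCategory).obj (𝟭 A) ⟶ resolution T where
  app n := iterMap T 0 (n.len + 1) ⟨Fin.elim0, fun i => i.elim0⟩
  naturality n m f := by
    refine (Category.id_comp _).trans (Eq.trans ?_ (iterMap_comp T 0 (n.len + 1) (m.len + 1)
      ⟨Fin.elim0, fun i => i.elim0⟩ f.toOrderHom))
    congr 1
    ext i
    exact i.elim0

variable {B : Type u} [Category.{v} B] {D : Type u₁} [Category.{v₁} D]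
  (T : Monad (B ⥤ D)) (s : (SimplexCategory ⥤ D) ⥤ D)

/-- The functor `F ↦ s([n] ↦ (T^(n + 1) F)(U))`. -/
def hyperAt (U : B) : (B ⥤ D) ⥤ D :=
  (resolution T ⋙ (Functor.whiskeringRight _ _ _).obj ((evaluation B D).obj U)).flip ⋙ s

/-- The dependence of `F ↦ s([n] ↦ (T^(n + 1) F)(U))` on `U`. -/
def hyperEval : B ⥤ (B ⥤ D) ⥤ D where
  obj U := hyperAt T s U
  map f := Functor.whiskerRight ((flipFunctor _ _ _).map
    (Functor.whiskerLeft (resolution T)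
      ((Functor.whiskeringRight _ _ _).map ((evaluation B D).map f)))) s
  map_id U := NatTrans.ext (funext fun F =>
    (congrArg s.map (NatTrans.ext (funext fun n => (((resolution T).obj n).obj F).map_id U))).trans
      (s.map_id _))
  map_comp f g := NatTrans.ext (funext fun F =>
    (congrArg s.map (NatTrans.ext (funext fun n =>
      (((resolution T).obj n).obj F).map_comp f g))).trans (s.map_comp _ _))

/-- The functor which applies the simple functor `s` objectwise to the cosimplicial resolution
`[n] ↦ T^(n + 1) F`. -/
def hyper : (B ⥤ D) ⥤ B ⥤ D := (hyperEval T s).flip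

variable {s} (lam : 𝟭 D ⟶ Functor.const SimplexCategory ⋙ s)

/-- The value at `U` of the morphism from `F` to its resolution. -/
def toHyperAt (U : B) : (evaluation B D).obj U ⟶ hyperAt T s U :=
  Functor.whiskerLeft ((evaluation B D).obj U) lam ≫
    Functor.whiskerRight ((flipFunctor _ _ _).map
      (Functor.whiskerRight (augmentation T)
        ((Functor.whiskeringRight _ _ _).obj ((evaluation B D).obj U)))) s

/-- The morphism from `F` to the simple of its resolution. -/
def toHyper : 𝟭 (B ⥤ D) ⟶ hyper T s where
  app F :=
    { app U := (toHyperAt T lam U).app F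
      naturality U V f := by
        change F.map f ≫ lam.app (F.obj V) ≫ s.map _ = (lam.app (F.obj U) ≫ s.map _) ≫ s.map _
        have h := lam.naturality (F.map f)
        change F.map f ≫ lam.app (F.obj V) =
          lam.app (F.obj U) ≫ s.map ((Functor.const SimplexCategory).map (F.map f)) at h
        rw [reassoc_of% h, Category.assoc, ← s.map_comp, ← s.map_comp]
        refine congrArg (fun x => lam.app (F.obj U) ≫ s.map x) (NatTrans.ext (funext fun n => ?_))
        exact (((augmentation T).app n).app F).naturality f }
  naturality F G α := by
    ext U
    exact (toHyperAt T lam U).naturality α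

end Hyper

section HyperLax

variable {B : Type u} [Category.{v} B] {D : Type u₁} [Category.{v₁} D] [MonoidalCategory D]
  [SymmetricCategory D] (T : Monad (B ⥤ D)) [T.toFunctor.LaxBraided] [NatTrans.IsMonoidal T.η]
  [NatTrans.IsMonoidal T.μ] {s : (SimplexCategory ⥤ D) ⥤ D} [s.LaxBraided]

instance (n : SimplexCategory) : ((resolution T).obj n).LaxBraided :=
  inferInstanceAs (iter T (n.len + 1)).LaxBraided

instance {n m : SimplexCategory} (f : n ⟶ m) : NatTrans.IsMonoidal ((resolution T).map f) :=
  inferInstanceAs (NatTrans.IsMonoidal (iterMap T _ _ f.toOrderHom))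

instance (n : SimplexCategory) :
    (((Functor.const SimplexCategory).obj (𝟭 (B ⥤ D))).obj n).LaxBraided :=
  inferInstanceAs (𝟭 (B ⥤ D)).LaxBraided

instance {n m : SimplexCategory} (f : n ⟶ m) :
    NatTrans.IsMonoidal (((Functor.const SimplexCategory).obj (𝟭 (B ⥤ D))).map f) :=
  inferInstanceAs (NatTrans.IsMonoidal (𝟙 (𝟭 (B ⥤ D))))

instance (n : SimplexCategory) : NatTrans.IsMonoidal ((augmentation T).app n) :=
  iterMap_isMonoidal T 0 (n.len + 1) ⟨Fin.elim0, fun i => i.elim0⟩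

/-- Evaluation at `U` after a diagram of functors. -/
abbrev evalAt {I : Type u₂} [Category.{v₂} I] (K : I ⥤ (B ⥤ D) ⥤ (B ⥤ D)) (U : B) :
    I ⥤ (B ⥤ D) ⥤ D :=
  K ⋙ (Functor.whiskeringRight _ _ _).obj ((evaluation B D).obj U)

instance {I : Type u₂} [Category.{v₂} I] (K : I ⥤ (B ⥤ D) ⥤ (B ⥤ D)) (U : B) (i : I)
    [(K.obj i).LaxBraided] : ((evalAt K U).obj i).LaxBraided :=
  inferInstanceAs (K.obj i ⋙ (evaluation B D).obj U).LaxBraided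

instance {I : Type u₂} [Category.{v₂} I] (K : I ⥤ (B ⥤ D) ⥤ (B ⥤ D)) (U : B) {i j : I} (f : i ⟶ j)
    [(K.obj i).LaxBraided] [(K.obj j).LaxBraided] [NatTrans.IsMonoidal (K.map f)] :
    NatTrans.IsMonoidal ((evalAt K U).map f) :=
  inferInstanceAs (NatTrans.IsMonoidal
    (Functor.whiskerRight (K.map f) ((evaluation B D).obj U)))

instance (U : B) : (hyperAt T s U).LaxBraided :=
  inferInstanceAs ((evalAt (resolution T) U).flip ⋙ s).LaxBraided

instance (U : B) : ((hyperEval T s).obj U).LaxBraided :=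
  inferInstanceAs (hyperAt T s U).LaxBraided

instance {U V : B} (f : U ⟶ V) : NatTrans.IsMonoidal ((hyperEval T s).map f) := by
  let τ : evalAt (resolution T) U ⟶ evalAt (resolution T) V :=
    Functor.whiskerLeft (resolution T)
      ((Functor.whiskeringRight _ _ _).map ((evaluation B D).map f))
  have (n : SimplexCategory) : NatTrans.IsMonoidal (τ.app n) :=
    inferInstanceAs (NatTrans.IsMonoidal
      (Functor.whiskerLeft ((resolution T).obj n) ((evaluation B D).map f)))
  let τ' : (evalAt (resolution T) U).flip ⟶ (evalAt (resolution T) V).flip :=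
    (flipFunctor _ _ _).map τ
  have : NatTrans.IsMonoidal τ' := flip_isMonoidal τ
  exact (inferInstance : NatTrans.IsMonoidal (Functor.whiskerRight τ' s))

instance : (hyper T s).LaxBraided :=
  inferInstanceAs (hyperEval T s).flip.LaxBraided

variable (lam : 𝟭 D ⟶ Functor.const SimplexCategory ⋙ s) [NatTrans.IsMonoidal lam]

instance (U : B) : NatTrans.IsMonoidal (toHyperAt T lam U) := by
  let τ : evalAt ((Functor.const SimplexCategory).obj (𝟭 (B ⥤ D))) U ⟶ evalAt (resolution T) U :=
    Functor.whiskerRight (augmentation T)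
      ((Functor.whiskeringRight _ _ _).obj ((evaluation B D).obj U))
  have (n : SimplexCategory) : NatTrans.IsMonoidal (τ.app n) :=
    inferInstanceAs (NatTrans.IsMonoidal
      (Functor.whiskerRight ((augmentation T).app n) ((evaluation B D).obj U)))
  have h := flip_isMonoidal τ
  let τ' : (evaluation B D).obj U ⋙ Functor.const SimplexCategory ⟶
      (evalAt (resolution T) U).flip := (flipFunctor _ _ _).map τ
  have : NatTrans.IsMonoidal τ' := ⟨h.unit, h.tensor⟩
  have h1 : NatTrans.IsMonoidal (Functor.whiskerRight τ' s) := inferInstance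
  have h2 : toHyperAt T lam U = (Functor.rightUnitor ((evaluation B D).obj U)).inv ≫
      Functor.whiskerLeft ((evaluation B D).obj U) lam ≫
      (Functor.associator ((evaluation B D).obj U) (Functor.const SimplexCategory) s).inv ≫
        Functor.whiskerRight τ' s :=
    NatTrans.ext (funext fun F =>
      (congrArg _ (Category.id_comp _).symm).trans (Category.id_comp _).symm)
  rw [h2]
  exact (inferInstance : NatTrans.IsMonoidal ((Functor.rightUnitor _).inv ≫
      Functor.whiskerLeft ((evaluation B D).obj U) lam ≫
      (Functor.associator ((evaluation B D).obj U) (Functor.const SimplexCategory) s).inv ≫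
        Functor.whiskerRight τ' s))

instance : NatTrans.IsMonoidal (toHyper T lam) where
  unit := NatTrans.ext (funext fun U => NatTrans.IsMonoidal.unit (τ := toHyperAt T lam U))
  tensor F G := NatTrans.ext (funext fun U =>
    NatTrans.IsMonoidal.tensor (τ := toHyperAt T lam U) F G)

end HyperLax

/-! ### Adjunctions of symmetric monoidal functors -/

section MonoidalAdjunction

open Functor.LaxMonoidal Functor.OplaxMonoidal

variable {A : Type u₁} [Category.{v₁} A] [MonoidalCategory A] [BraidedCategory A]
  {B : Type u₂} [Category.{v₂} B] [MonoidalCategory B] [BraidedCategory B]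
  {F : A ⥤ B} {G : B ⥤ A} (adj : F ⊣ G) [F.Braided]

/-- The right adjoint of a strong symmetric monoidal functor is lax symmetric monoidal. -/
@[reducible]
def rightAdjointLaxBraided : G.LaxBraided :=
  letI := adj.rightAdjointLaxMonoidal
  { braided X Y := by
      apply (adj.homEquiv _ _).symm.injective
      rw [Adjunction.homEquiv_naturality_right_symm, Adjunction.homEquiv_naturality_left_symm]
      rw [adj.rightAdjointLaxMonoidal_μ, adj.rightAdjointLaxMonoidal_μ, Equiv.symm_apply_apply,
        Equiv.symm_apply_apply, Functor.map_braiding]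
      simp }

lemma rightAdjoint_isMonoidal :
    letI := rightAdjointLaxBraided adj
    adj.IsMonoidal :=
  letI := adj.rightAdjointLaxMonoidal
  { }

variable [G.LaxBraided] [adj.IsMonoidal]

instance toMonadLaxBraided : adj.toMonad.toFunctor.LaxBraided :=
  inferInstanceAs (F ⋙ G).LaxBraided

instance : NatTrans.IsMonoidal adj.toMonad.η :=
  inferInstanceAs (NatTrans.IsMonoidal adj.unit)

instance : NatTrans.IsMonoidal adj.toMonad.μ := by
  have h : adj.toMonad.μ = (Functor.associator F G (F ⋙ G)).hom ≫
      Functor.whiskerLeft F ((Functor.associator G F G).inv ≫ Functor.whiskerRight adj.counit G ≫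
        (Functor.leftUnitor G).hom) := by
    refine NatTrans.ext (funext fun X => ?_)
    refine Eq.trans ?_ (Category.id_comp _).symm
    refine Eq.trans ?_ (Category.id_comp _).symm
    exact (Category.comp_id _).symm
  have h' : NatTrans.IsMonoidal ((Functor.associator F G (F ⋙ G)).hom ≫
      Functor.whiskerLeft F ((Functor.associator G F G).inv ≫ Functor.whiskerRight adj.counit G ≫
        (Functor.leftUnitor G).hom)) := inferInstance
  rw [← h] at h'
  exact h'

end MonoidalAdjunction

/-! ### Stalks of presheaves -/

section Aux

variable {D : Type u₁} [Category.{v₁} D]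

lemma oplax_aux [MonoidalCategory D] {a b c A B C' AB BC L R : D} (f : a ⟶ A) (g : b ⟶ B) (h : c ⟶ C')
    (fg : a ⊗ b ⟶ AB) (gh : b ⊗ c ⟶ BC) (l : (a ⊗ b) ⊗ c ⟶ L) (r : a ⊗ b ⊗ c ⟶ R)
    (φ : L ⟶ R) (δL : L ⟶ AB ⊗ C') (δR : R ⟶ A ⊗ BC) (δ₁ : AB ⟶ A ⊗ B) (δ₂ : BC ⟶ B ⊗ C')
    (h0 : l ≫ φ = (α_ a b c).hom ≫ r) (h1 : l ≫ δL = fg ⊗ₘ h) (h2 : r ≫ δR = f ⊗ₘ gh)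
    (h3 : fg ≫ δ₁ = f ⊗ₘ g) (h4 : gh ≫ δ₂ = g ⊗ₘ h) :
    l ≫ δL ≫ δ₁ ▷ C' ≫ (α_ A B C').hom = l ≫ φ ≫ δR ≫ A ◁ δ₂ := by
  rw [reassoc_of% h0, reassoc_of% h1, reassoc_of% h2, tensorHom_comp_whiskerLeft, h4,
    ← Category.assoc, tensorHom_comp_whiskerRight, h3, associator_naturality]

lemma braided_aux {X Y Z W : D} (μ₁ : X ⟶ Y) (δ₁ : Y ⟶ X) (b : Y ⟶ Z) (μ₂ : W ⟶ Z) (δ₂ : Z ⟶ W)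
    (β : X ⟶ W) (h₁ : μ₁ ≫ δ₁ = 𝟙 X) (h₂ : δ₂ ≫ μ₂ = 𝟙 Z) (h : b ≫ δ₂ = δ₁ ≫ β) :
    μ₁ ≫ b = β ≫ μ₂ := by
  rw [← Category.comp_id b, ← h₂, reassoc_of% h, reassoc_of% h₁]

end Aux

section Stalk

open Functor.LaxMonoidal Functor.OplaxMonoidal

variable {C : Type u} [Category.{v} C] [LocallySmall.{w} C] {J : GrothendieckTopology C}
  (Φ : J.Point) {D : Type u₁} [Category.{v₁} D] [HasFilteredColimitsOfSize.{w, w} D]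

lemma hasColimits_elements (Φ : GrothendieckTopology.Point.{w} J) :
    HasColimitsOfShape Φ.fiber.Elementsᵒᵖ D :=
  Functor.Final.hasColimitsOfShape_of_final (FinallySmall.fromFilteredFinalModel.{w} _)

attribute [instance] hasColimits_elements

variable (D) (Φ : GrothendieckTopology.Point.{w} J)

/-- The stalk of presheaves at a point of a site. -/
def stalk : (Cᵒᵖ ⥤ D) ⥤ D :=
  (Functor.whiskeringLeft _ _ _).obj (CategoryOfElements.π Φ.fiber).op ⋙ colim

variable {D}

/-- The map from the sections over a neighbourhood of a point to the stalk. -/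
def germ (F : Cᵒᵖ ⥤ D) (U : C) (x : Φ.fiber.obj U) : F.obj (op U) ⟶ (stalk D Φ).obj F :=
  colimit.ι ((CategoryOfElements.π Φ.fiber).op ⋙ F) (op ⟨U, x⟩)

lemma stalk_hom_ext {F : Cᵒᵖ ⥤ D} {A : D} {f g : (stalk D Φ).obj F ⟶ A}
    (h : ∀ (U : C) (x : Φ.fiber.obj U), germ Φ F U x ≫ f = germ Φ F U x ≫ g) : f = g :=
  colimit.hom_ext (by rintro ⟨⟨U, x⟩⟩; exact h U x)

@[simp]
lemma germ_res (F : Cᵒᵖ ⥤ D) {U V : C} (f : U ⟶ V) (x : Φ.fiber.obj U) :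
    F.map f.op ≫ germ Φ F U x = germ Φ F V (Φ.fiber.map f x) :=
  colimit.w ((CategoryOfElements.π Φ.fiber).op ⋙ F)
    (CategoryOfElements.homMk ⟨U, x⟩ ⟨V, Φ.fiber.map f x⟩ f rfl).op

@[simp]
lemma germ_map {F G : Cᵒᵖ ⥤ D} (f : F ⟶ G) (U : C) (x : Φ.fiber.obj U) :
    germ Φ F U x ≫ (stalk D Φ).map f = f.app (op U) ≫ germ Φ G U x :=
  ι_colimMap _ _

/-- Morphisms from a stalk. -/
def stalkDesc {F : Cᵒᵖ ⥤ D} {A : D} (φ : ∀ (U : C) (_ : Φ.fiber.obj U), F.obj (op U) ⟶ A)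
    (hφ : ∀ ⦃U V : C⦄ (f : U ⟶ V) (x : Φ.fiber.obj U),
      F.map f.op ≫ φ U x = φ V (Φ.fiber.map f x)) : (stalk D Φ).obj F ⟶ A :=
  colimit.desc ((CategoryOfElements.π Φ.fiber).op ⋙ F)
    { pt := A
      ι :=
        { app x := φ x.unop.1 x.unop.2
          naturality x y f := by
            refine ((hφ f.unop.1 y.unop.2).trans ?_).trans (Category.comp_id _).symm
            exact congrArg (φ x.unop.1) f.unop.2 } }

@[simp]
lemma germ_stalkDesc {F : Cᵒᵖ ⥤ D} {A : D} (φ : ∀ (U : C) (_ : Φ.fiber.obj U), F.obj (op U) ⟶ A)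
    (hφ : ∀ ⦃U V : C⦄ (f : U ⟶ V) (x : Φ.fiber.obj U),
      F.map f.op ≫ φ U x = φ V (Φ.fiber.map f x)) (U : C) (x : Φ.fiber.obj U) :
    germ Φ F U x ≫ stalkDesc Φ φ hφ = φ U x :=
  colimit.ι_desc _ _

/-- The colimit cocone which defines the stalk. -/
@[reducible]
def stalkCocone (F : Cᵒᵖ ⥤ D) : Cocone ((CategoryOfElements.π Φ.fiber).op ⋙ F) where
  pt := (stalk D Φ).obj F
  ι := (colimit.cocone ((CategoryOfElements.π Φ.fiber).op ⋙ F)).ι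

/-- The stalk is a colimit. -/
def isColimitStalkCocone (F : Cᵒᵖ ⥤ D) : IsColimit (stalkCocone Φ F) :=
  colimit.isColimit _

variable [MonoidalCategory D]

/-- The comparison map of the stalk of the unit. -/
def stalkη : (stalk D Φ).obj (𝟙_ (Cᵒᵖ ⥤ D)) ⟶ 𝟙_ D :=
  stalkDesc Φ (fun _ _ => 𝟙 (𝟙_ D)) (fun _ _ _ _ => Category.comp_id _)

/-- The germs of the unit. -/
def germU (U : C) (x : Φ.fiber.obj U) : 𝟙_ D ⟶ (stalk D Φ).obj (𝟙_ (Cᵒᵖ ⥤ D)) :=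
  germ Φ (𝟙_ (Cᵒᵖ ⥤ D)) U x

lemma germ_η (U : C) (x : Φ.fiber.obj U) : germU Φ U x ≫ stalkη Φ = 𝟙 (𝟙_ D) :=
  germ_stalkDesc Φ _ _ _ _

/-- The germs of a tensor product. -/
def germT (F G : Cᵒᵖ ⥤ D) (U : C) (x : Φ.fiber.obj U) :
    F.obj (op U) ⊗ G.obj (op U) ⟶ (stalk D Φ).obj (F ⊗ G) :=
  germ Φ (F ⊗ G) U x

/-- The comparison map of the stalk of a tensor product. -/
def stalkδ (F G : Cᵒᵖ ⥤ D) : (stalk D Φ).obj (F ⊗ G) ⟶ (stalk D Φ).obj F ⊗ (stalk D Φ).obj G :=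
  stalkDesc Φ (fun U x => germ Φ F U x ⊗ₘ germ Φ G U x) (fun U V f x => by
    change (F.map f.op ⊗ₘ G.map f.op) ≫ _ = _
    rw [tensorHom_comp_tensorHom, germ_res, germ_res])

lemma germ_δ (F G : Cᵒᵖ ⥤ D) (U : C) (x : Φ.fiber.obj U) :
    germT Φ F G U x ≫ stalkδ Φ F G = germ Φ F U x ⊗ₘ germ Φ G U x :=
  germ_stalkDesc Φ _ _ _ _

instance stalkOplaxMonoidal : (stalk D Φ).OplaxMonoidal where
  η := stalkη Φ
  δ F G := stalkδ Φ F G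
  δ_natural_left {F F'} f G := stalk_hom_ext Φ fun U x => by
    have h : germT Φ F G U x ≫ (stalk D Φ).map (f ▷ G) =
      (f.app (op U) ▷ G.obj (op U)) ≫ germT Φ F' G U x := germ_map Φ (f ▷ G) U x
    change germT Φ F G U x ≫ _ = germT Φ F G U x ≫ _
    rw [reassoc_of% h, reassoc_of% (germ_δ Φ F G U x), germ_δ, tensorHom_comp_whiskerRight,
      whiskerRight_comp_tensorHom, germ_map]
  δ_natural_right {G G'} F g := stalk_hom_ext Φ fun U x => by
    have h : germT Φ F G U x ≫ (stalk D Φ).map (F ◁ g) =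
      (F.obj (op U) ◁ g.app (op U)) ≫ germT Φ F G' U x := germ_map Φ (F ◁ g) U x
    change germT Φ F G U x ≫ _ = germT Φ F G U x ≫ _
    rw [reassoc_of% h, reassoc_of% (germ_δ Φ F G U x), germ_δ, tensorHom_comp_whiskerLeft,
      whiskerLeft_comp_tensorHom, germ_map]
  oplax_associativity F G H := stalk_hom_ext Φ fun U x => by
    have h : germT Φ (F ⊗ G) H U x ≫ (stalk D Φ).map (α_ F G H).hom =
      (α_ (F.obj (op U)) (G.obj (op U)) (H.obj (op U))).hom ≫ germT Φ F (G ⊗ H) U x :=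
      germ_map Φ (α_ F G H).hom U x
    have h1 : germT Φ (F ⊗ G) H U x ≫ stalkδ Φ (F ⊗ G) H = germT Φ F G U x ⊗ₘ germ Φ H U x :=
      germ_δ Φ (F ⊗ G) H U x
    have h2 : germT Φ F (G ⊗ H) U x ≫ stalkδ Φ F (G ⊗ H) = germ Φ F U x ⊗ₘ germT Φ G H U x :=
      germ_δ Φ F (G ⊗ H) U x
    exact oplax_aux _ _ _ _ _ _ _ _ _ _ _ _ h h1 h2 (germ_δ Φ F G U x) (germ_δ Φ G H U x)
  oplax_left_unitality F := stalk_hom_ext Φ fun U x => by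
    have h : germ Φ F U x ≫ (stalk D Φ).map (λ_ F).inv =
      (λ_ (F.obj (op U))).inv ≫ germT Φ (𝟙_ _) F U x := germ_map Φ (λ_ F).inv U x
    have h1 : germT Φ (𝟙_ _) F U x ≫ stalkδ Φ (𝟙_ _) F = germU Φ U x ⊗ₘ germ Φ F U x :=
      germ_δ Φ (𝟙_ _) F U x
    rw [leftUnitor_inv_naturality, reassoc_of% h, reassoc_of% h1, tensorHom_comp_whiskerRight,
      germ_η, id_tensorHom]
  oplax_right_unitality F := stalk_hom_ext Φ fun U x => by
    have h : germ Φ F U x ≫ (stalk D Φ).map (ρ_ F).inv =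
      (ρ_ (F.obj (op U))).inv ≫ germT Φ F (𝟙_ _) U x := germ_map Φ (ρ_ F).inv U x
    have h1 : germT Φ F (𝟙_ _) U x ≫ stalkδ Φ F (𝟙_ _) = germ Φ F U x ⊗ₘ germU Φ U x :=
      germ_δ Φ F (𝟙_ _) U x
    rw [rightUnitor_inv_naturality, reassoc_of% h, reassoc_of% h1, tensorHom_comp_whiskerLeft,
      germ_η, tensorHom_id]

section Braided

variable [SymmetricCategory D] [∀ A : D, PreservesFilteredColimitsOfSize.{w, w} (tensorLeft A)]

instance (A : D) : PreservesColimitsOfShape Φ.fiber.Elementsᵒᵖ ((curriedTensor D).obj A) :=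
  have : PreservesFilteredColimitsOfSize.{w, w} ((curriedTensor D).obj A) :=
    inferInstanceAs (PreservesFilteredColimitsOfSize.{w, w} (tensorLeft A))
  Functor.Final.preservesColimitsOfShape_of_final (FinallySmall.fromFilteredFinalModel.{w} _) _

instance (A : D) : PreservesColimitsOfShape Φ.fiber.Elementsᵒᵖ ((curriedTensor D).flip.obj A) :=
  preservesColimitsOfShape_of_natIso
    (NatIso.ofComponents (fun X => β_ A X) (fun f => by simp) :
      (curriedTensor D).obj A ≅ (curriedTensor D).flip.obj A)

instance : IsIso (η (stalk D Φ)) :=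
  have := IsFiltered.isConnected Φ.fiber.Elementsᵒᵖ
  (IsColimit.coconePointUniqueUpToIso (isColimitStalkCocone Φ (𝟙_ (Cᵒᵖ ⥤ D)))
    (isColimitConstCocone Φ.fiber.Elementsᵒᵖ (𝟙_ D))).isIso_hom

instance (F G : Cᵒᵖ ⥤ D) : IsIso (δ (stalk D Φ) F G) :=
  (IsColimit.coconePointUniqueUpToIso (isColimitStalkCocone Φ (F ⊗ G))
    ((isColimitStalkCocone Φ F).tensor (isColimitStalkCocone Φ G))).isIso_hom

instance stalkMonoidal : (stalk D Φ).Monoidal :=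
  .ofOplaxMonoidal _

instance stalkBraided : (stalk D Φ).Braided where
  braided F G := by
    refine braided_aux _ (δ (stalk D Φ) F G) _ _ (δ (stalk D Φ) G F) _
      (Functor.Monoidal.μ_δ _ _ _) (Functor.Monoidal.δ_μ _ _ _) (stalk_hom_ext Φ fun U x => ?_)
    have h : germT Φ F G U x ≫ (stalk D Φ).map (β_ F G).hom =
      (β_ (F.obj (op U)) (G.obj (op U))).hom ≫ germT Φ G F U x := germ_map Φ (β_ F G).hom U x
    change germT Φ F G U x ≫ (stalk D Φ).map (β_ F G).hom ≫ stalkδ Φ G F =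
      germT Φ F G U x ≫ stalkδ Φ F G ≫ (β_ ((stalk D Φ).obj F) ((stalk D Φ).obj G)).hom
    rw [reassoc_of% h, reassoc_of% (germ_δ Φ F G U x), germ_δ, BraidedCategory.braiding_naturality]

end Braided

end Stalk

/-! ### The Godement monad of a family of points -/

section Godement

open Functor.LaxMonoidal Functor.OplaxMonoidal

variable {C : Type u} [Category.{v} C] {J : GrothendieckTopology C}
  {X : Type w} (pt : X → GrothendieckTopology.Point.{w} J) (D : Type u₁) [Category.{v₁} D]

section Skyscraper

variable [HasProducts.{w} D]

variable {D}

/-- The value at `U` of the product over `x` of the skyscraper sheaves `x_* A_x`: it is the product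
of copies of `A_x` over all `x` and all elements of the fibre of `U` at `x`. -/
def skyObj (A : Discrete X ⥤ D) (U : C) : D :=
  ∏ᶜ fun i : (Σ x : X, (pt x).fiber.obj U) => A.obj ⟨i.1⟩

/-- The projections from the values of the product of the skyscraper sheaves. -/
def skyπ (A : Discrete X ⥤ D) (U : C) (x : Discrete X) (y : (pt x.as).fiber.obj U) :
    skyObj pt A U ⟶ A.obj x :=
  Pi.π (fun i : (Σ x : X, (pt x).fiber.obj U) => A.obj ⟨i.1⟩) ⟨x.as, y⟩

/-- Morphisms to the values of the product of the skyscraper sheaves. -/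
def skyLift {B : D} (A : Discrete X ⥤ D) (U : C)
    (b : ∀ (x : Discrete X) (_ : (pt x.as).fiber.obj U), B ⟶ A.obj x) : B ⟶ skyObj pt A U :=
  Pi.lift fun i : (Σ x : X, (pt x).fiber.obj U) => b ⟨i.1⟩ i.2

lemma skyLift_π {B : D} (A : Discrete X ⥤ D) (U : C)
    (b : ∀ (x : Discrete X) (_ : (pt x.as).fiber.obj U), B ⟶ A.obj x) (x : Discrete X)
    (y : (pt x.as).fiber.obj U) : skyLift pt A U b ≫ skyπ pt A U x y = b x y :=
  Pi.lift_π (f := fun i : (Σ x : X, (pt x).fiber.obj U) => A.obj ⟨i.1⟩) _ _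

variable {pt} in
lemma sky_hom_ext {B : D} {A : Discrete X ⥤ D} {U : C} {f g : B ⟶ skyObj pt A U}
    (h : ∀ (x : Discrete X) (y : (pt x.as).fiber.obj U),
      f ≫ skyπ pt A U x y = g ≫ skyπ pt A U x y) : f = g :=
  Pi.hom_ext _ _ fun i => h ⟨i.1⟩ i.2

/-- The restriction maps of the product of the skyscraper sheaves. -/
def skyRes (A : Discrete X ⥤ D) {U V : C} (f : V ⟶ U) : skyObj pt A U ⟶ skyObj pt A V :=
  skyLift pt A V fun x y => skyπ pt A U x ((pt x.as).fiber.map f y)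

lemma skyRes_π (A : Discrete X ⥤ D) {U V : C} (f : V ⟶ U) (x : Discrete X)
    (y : (pt x.as).fiber.obj V) :
    skyRes pt A f ≫ skyπ pt A V x y = skyπ pt A U x ((pt x.as).fiber.map f y) :=
  skyLift_π pt A V _ x y

/-- The functoriality of the product of the skyscraper sheaves. -/
def skyMap {A B : Discrete X ⥤ D} (a : A ⟶ B) (U : C) : skyObj pt A U ⟶ skyObj pt B U :=
  skyLift pt B U fun x y => skyπ pt A U x y ≫ a.app x

lemma skyMap_π {A B : Discrete X ⥤ D} (a : A ⟶ B) (U : C) (x : Discrete X)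
    (y : (pt x.as).fiber.obj U) :
    skyMap pt a U ≫ skyπ pt B U x y = skyπ pt A U x y ≫ a.app x :=
  skyLift_π pt B U _ x y

variable (D)

/-- The functor `p_*`: its value on a family `(A_x)` is the product of the skyscraper sheaves
`x_* A_x`. -/
def skyscrapers : (Discrete X ⥤ D) ⥤ Cᵒᵖ ⥤ D where
  obj A :=
    { obj U := skyObj pt A U.unop
      map f := skyRes pt A f.unop
      map_id U := sky_hom_ext fun x y => by
        rw [skyRes_π, Category.id_comp]
        exact congrArg (skyπ pt A U.unop x) (by simp)
      map_comp f g := sky_hom_ext fun x y => by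
        rw [skyRes_π, Category.assoc, skyRes_π, skyRes_π]
        exact congrArg (skyπ pt A _ x) (by simp) }
  map a :=
    { app U := skyMap pt a U.unop
      naturality U V f := sky_hom_ext fun x y => by
        rw [Category.assoc, Category.assoc, skyMap_π, skyRes_π, reassoc_of% (skyRes_π pt _ f.unop),
          skyMap_π] }
  map_id A := NatTrans.ext (funext fun U => sky_hom_ext fun x y => by
    rw [skyMap_π]
    exact (Category.comp_id _).trans (Category.id_comp _).symm)
  map_comp a b := NatTrans.ext (funext fun U => sky_hom_ext fun x y => by
    refine (skyMap_π pt (a ≫ b) U.unop x y).trans ?_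
    refine Eq.trans ?_ (Category.assoc _ _ _).symm
    refine Eq.trans ?_ (congrArg (_ ≫ ·) (skyMap_π pt b U.unop x y).symm)
    refine Eq.trans ?_ (Category.assoc _ _ _)
    refine Eq.trans ?_ (congrArg (· ≫ _) (skyMap_π pt a U.unop x y).symm)
    exact (Category.assoc _ _ _).symm)

end Skyscraper

variable [LocallySmall.{w} C] [HasFilteredColimitsOfSize.{w, w} D]

/-- The functor `p^*`: its value on a presheaf is the family of stalks. -/
def stalks : (Cᵒᵖ ⥤ D) ⥤ Discrete X ⥤ D :=
  (Discrete.functor fun x => stalk D (pt x)).flip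

variable [HasProducts.{w} D]

variable {D}

/-- The value at `U` of the morphism `F ⟶ p_* A` which is adjoint to `p^* F ⟶ A`. -/
def toSkyAt {F : Cᵒᵖ ⥤ D} {A : Discrete X ⥤ D} (a : (stalks pt D).obj F ⟶ A) (U : C) :
    F.obj (op U) ⟶ skyObj pt A U :=
  skyLift pt A U fun x y => germ (pt x.as) F U y ≫ a.app x

lemma toSkyAt_π {F : Cᵒᵖ ⥤ D} {A : Discrete X ⥤ D} (a : (stalks pt D).obj F ⟶ A) (U : C)
    (x : Discrete X) (y : (pt x.as).fiber.obj U) :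
    toSkyAt pt a U ≫ skyπ pt A U x y = germ (pt x.as) F U y ≫ a.app x :=
  skyLift_π pt A U _ x y

/-- The morphism `F ⟶ p_* A` which is adjoint to `p^* F ⟶ A`. -/
def toSky {F : Cᵒᵖ ⥤ D} {A : Discrete X ⥤ D} (a : (stalks pt D).obj F ⟶ A) :
    F ⟶ (skyscrapers pt D).obj A where
  app U := toSkyAt pt a U.unop
  naturality U V f := sky_hom_ext fun x y => by
    refine (Category.assoc _ _ _).trans ?_
    refine (congrArg (_ ≫ ·) (toSkyAt_π pt a V.unop x y)).trans ?_
    refine Eq.trans ?_ (Category.assoc _ _ _).symm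
    refine Eq.trans ?_ (congrArg (_ ≫ ·) (skyRes_π pt A f.unop x y).symm)
    refine Eq.trans ?_ (toSkyAt_π pt a U.unop x _).symm
    refine (Category.assoc _ _ _).symm.trans ?_
    exact congrArg (· ≫ _) (germ_res (pt x.as) F f.unop y)

/-- The component at `x` of the morphism `p^* F ⟶ A` which is adjoint to `F ⟶ p_* A`. -/
def ofSkyAt {F : Cᵒᵖ ⥤ D} {A : Discrete X ⥤ D} (b : F ⟶ (skyscrapers pt D).obj A)
    (x : Discrete X) : (stalk D (pt x.as)).obj F ⟶ A.obj x :=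
  stalkDesc (pt x.as) (fun U y => b.app (op U) ≫ skyπ pt A U x y) (fun U V f y => by
    refine (Category.assoc _ _ _).symm.trans ?_
    refine (congrArg (· ≫ _) (b.naturality f.op)).trans ?_
    refine (Category.assoc _ _ _).trans ?_
    exact congrArg (_ ≫ ·) (skyRes_π pt A f x y))

lemma germ_ofSkyAt {F : Cᵒᵖ ⥤ D} {A : Discrete X ⥤ D} (b : F ⟶ (skyscrapers pt D).obj A)
    (x : Discrete X) (U : C) (y : (pt x.as).fiber.obj U) :
    germ (pt x.as) F U y ≫ ofSkyAt pt b x = b.app (op U) ≫ skyπ pt A U x y :=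
  germ_stalkDesc _ _ _ _ _

/-- The morphism `p^* F ⟶ A` which is adjoint to `F ⟶ p_* A`. -/
def ofSky {F : Cᵒᵖ ⥤ D} {A : Discrete X ⥤ D} (b : F ⟶ (skyscrapers pt D).obj A) :
    (stalks pt D).obj F ⟶ A where
  app x := ofSkyAt pt b x
  naturality x x' f := by
    obtain ⟨x⟩ := x
    obtain rfl := Discrete.eq_of_hom f
    have : f = 𝟙 _ := Subsingleton.elim _ _
    subst this
    rw [CategoryTheory.Functor.map_id, CategoryTheory.Functor.map_id]
    exact (Category.id_comp _).trans (Category.comp_id _).symm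

variable (D)

/-- The functor `p^*` is left adjoint to `p_*`. -/
def stalksAdjunction : stalks pt D ⊣ skyscrapers pt D :=
  Adjunction.mkOfHomEquiv
    { homEquiv F A :=
        { toFun a := toSky pt a
          invFun b := ofSky pt b
          left_inv a := NatTrans.ext (funext fun x => stalk_hom_ext (pt x.as) fun U y =>
            (germ_ofSkyAt pt (toSky pt a) x U y).trans (toSkyAt_π pt a U x y))
          right_inv b := NatTrans.ext (funext fun U => sky_hom_ext fun x y =>
            (toSkyAt_π pt (ofSky pt b) U.unop x y).trans (germ_ofSkyAt pt b x U.unop y)) }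
      homEquiv_naturality_left_symm f g :=
        NatTrans.ext (funext fun x => stalk_hom_ext (pt x.as) fun U y => by
          refine (germ_ofSkyAt pt (f ≫ g) x U y).trans ?_
          refine Eq.trans ?_ (Category.assoc _ _ _)
          refine Eq.trans ?_ (congrArg (· ≫ _) (germ_map (pt x.as) f U y).symm)
          refine Eq.trans ?_ (Category.assoc _ _ _).symm
          refine Eq.trans ?_ (congrArg (_ ≫ ·) (germ_ofSkyAt pt g x U y).symm)
          exact Category.assoc _ _ _)
      homEquiv_naturality_right f g :=
        NatTrans.ext (funext fun U => sky_hom_ext fun x y => by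
          refine (toSkyAt_π pt (f ≫ g) U.unop x y).trans ?_
          refine Eq.trans ?_ (Category.assoc _ _ _).symm
          refine Eq.trans ?_ (congrArg (_ ≫ ·) (skyMap_π pt g U.unop x y).symm)
          refine Eq.trans ?_ (Category.assoc _ _ _)
          refine Eq.trans ?_ (congrArg (· ≫ _) (toSkyAt_π pt f U.unop x y).symm)
          exact (Category.assoc _ _ _).symm) }

/-- The monad `T = p_* p^*`. -/
def godement : Monad (Cᵒᵖ ⥤ D) := (stalksAdjunction pt D).toMonad

variable [MonoidalCategory D] [SymmetricCategory D]
  [∀ A : D, PreservesFilteredColimitsOfSize.{w, w} (tensorLeft A)]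

instance (x : Discrete X) : ((Discrete.functor fun x => stalk D (pt x)).obj x).Braided :=
  stalkBraided (pt x.as)

instance {x y : Discrete X} (f : x ⟶ y) :
    NatTrans.IsMonoidal ((Discrete.functor fun x => stalk D (pt x)).map f) := by
  obtain ⟨x⟩ := x
  obtain rfl := Discrete.eq_of_hom f
  have : f = 𝟙 _ := Subsingleton.elim _ _
  subst this
  rw [CategoryTheory.Functor.map_id]
  infer_instance

instance stalksLaxBraided : (stalks pt D).LaxBraided :=
  inferInstanceAs (Discrete.functor fun x => stalk D (pt x)).flip.LaxBraided

instance : IsIso (ε (stalks pt D)) :=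
  have (x : Discrete X) : IsIso ((ε (stalks pt D)).app x) :=
    inferInstanceAs (IsIso (ε (stalk D (pt x.as))))
  NatIso.isIso_of_isIso_app _

instance (F G : Cᵒᵖ ⥤ D) : IsIso (μ (stalks pt D) F G) :=
  have (x : Discrete X) : IsIso ((μ (stalks pt D) F G).app x) :=
    inferInstanceAs (IsIso (μ (stalk D (pt x.as)) F G))
  NatIso.isIso_of_isIso_app _

instance stalksMonoidal : (stalks pt D).Monoidal := .ofLaxMonoidal _

instance stalksBraided : (stalks pt D).Braided where
  braided := (stalksLaxBraided pt D).braided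

instance skyscrapersLaxBraided : (skyscrapers pt D).LaxBraided :=
  rightAdjointLaxBraided (stalksAdjunction pt D)

instance : (stalksAdjunction pt D).IsMonoidal :=
  rightAdjoint_isMonoidal (stalksAdjunction pt D)

instance : (godement pt D).toFunctor.LaxBraided :=
  inferInstanceAs (stalksAdjunction pt D).toMonad.toFunctor.LaxBraided

instance : NatTrans.IsMonoidal (godement pt D).η :=
  inferInstanceAs (NatTrans.IsMonoidal (stalksAdjunction pt D).toMonad.η)

instance : NatTrans.IsMonoidal (godement pt D).μ :=
  inferInstanceAs (NatTrans.IsMonoidal (stalksAdjunction pt D).toMonad.μ)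

end Godement

/-! ### The symmetric monoidal category of sheaves -/

section LaxTransport

open Functor.LaxMonoidal

variable {A : Type u₁} [Category.{v₁} A] [MonoidalCategory A] [BraidedCategory A]
  {B : Type u₂} [Category.{v₂} B] [MonoidalCategory B] [BraidedCategory B]

/-- Transport of a lax monoidal structure along an isomorphism of functors. -/
@[reducible]
def laxTransport {F G : A ⥤ B} (i : F ≅ G) [F.LaxMonoidal] : G.LaxMonoidal :=
  .ofTensorHom (ε := ε F ≫ i.hom.app _)
    (μ := fun X Y => (i.inv.app X ⊗ₘ i.inv.app Y) ≫ μ F X Y ≫ i.hom.app _)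
    (μ_natural := fun f g => by
      rw [tensorHom_comp_tensorHom_assoc, i.inv.naturality, i.inv.naturality,
        ← tensorHom_comp_tensorHom_assoc, μ_natural_assoc, i.hom.naturality]
      simp)
    (associativity := fun X Y Z => by
      simp only [tensorHom_comp_tensorHom_assoc, Category.assoc, i.hom_inv_id_app,
       Category.comp_id, Category.id_comp, ← i.hom.naturality]
      have h := associativity F X Y Z
      rw [← tensorHom_id, ← id_tensorHom] at h
      have h1 : (((i.inv.app X ⊗ₘ i.inv.app Y) ≫ μ F X Y) ⊗ₘ i.inv.app Z) =
        ((i.inv.app X ⊗ₘ i.inv.app Y) ⊗ₘ i.inv.app Z) ≫ (μ F X Y ⊗ₘ 𝟙 _) := by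
        rw [tensorHom_comp_tensorHom, Category.comp_id]
      have h2 : (i.inv.app X ⊗ₘ ((i.inv.app Y ⊗ₘ i.inv.app Z) ≫ μ F Y Z)) =
        (i.inv.app X ⊗ₘ i.inv.app Y ⊗ₘ i.inv.app Z) ≫ (𝟙 _ ⊗ₘ μ F Y Z) := by
        rw [tensorHom_comp_tensorHom, Category.comp_id]
      rw [h1, h2, Category.assoc, Category.assoc, reassoc_of% h, associator_naturality_assoc])
    (left_unitality := fun X => by
      simp only [tensorHom_comp_tensorHom_assoc, Category.assoc, i.hom_inv_id_app,
       Category.comp_id, Category.id_comp, ← i.hom.naturality]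
      have h := left_unitality F X
      rw [← tensorHom_id] at h
      have h1 : (ε F ⊗ₘ i.inv.app X) = (𝟙 _ ⊗ₘ i.inv.app X) ≫ (ε F ⊗ₘ 𝟙 _) := by
        rw [tensorHom_comp_tensorHom, Category.comp_id, Category.id_comp]
      rw [h1, Category.assoc, ← reassoc_of% h, id_tensorHom, leftUnitor_naturality_assoc,
        i.inv_hom_id_app, Category.comp_id])
    (right_unitality := fun X => by
      simp only [tensorHom_comp_tensorHom_assoc, Category.assoc, i.hom_inv_id_app,
       Category.comp_id, Category.id_comp, ← i.hom.naturality]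
      have h := right_unitality F X
      rw [← id_tensorHom] at h
      have h1 : (i.inv.app X ⊗ₘ ε F) = (i.inv.app X ⊗ₘ 𝟙 _) ≫ (𝟙 _ ⊗ₘ ε F) := by
        rw [tensorHom_comp_tensorHom, Category.comp_id, Category.id_comp]
      rw [h1, Category.assoc, ← reassoc_of% h, tensorHom_id, rightUnitor_naturality_assoc,
        i.inv_hom_id_app, Category.comp_id])

/-- Transport of a lax symmetric monoidal structure along an isomorphism of functors. -/
@[reducible]
def laxBraidedTransport {F G : A ⥤ B} (i : F ≅ G) [F.LaxBraided] : G.LaxBraided where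
  toLaxMonoidal := laxTransport i
  braided X Y := by
    change ((i.inv.app X ⊗ₘ i.inv.app Y) ≫ μ F X Y ≫ i.hom.app _) ≫ _ =
      _ ≫ (i.inv.app _ ⊗ₘ i.inv.app _) ≫ μ F _ _ ≫ i.hom.app _
    rw [Category.assoc, Category.assoc, ← i.hom.naturality,
      reassoc_of% (Functor.LaxBraided.braided (F := F) X Y), ← BraidedCategory.braiding_naturality_assoc]

end LaxTransport

section Sheaves

variable {C : Type u} [Category.{v} C] (J : GrothendieckTopology C) (D : Type u₁)
  [Category.{v₁} D] [MonoidalCategory D] [SymmetricCategory D] [HasWeakSheafify J D]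
  [(J.W (A := D)).IsMonoidal]

attribute [instance] Sheaf.monoidalCategory Sheaf.symmetricCategory

instance presheafToSheafBraided : (presheafToSheaf J D).Braided :=
  inferInstanceAs (Localization.Monoidal.toMonoidalCategory
    (L := presheafToSheaf J D) (W := J.W) (Iso.refl _)).Braided

instance sheafToPresheafLaxBraided : (sheafToPresheaf J D).LaxBraided :=
  rightAdjointLaxBraided (sheafificationAdjunction J D)

instance : (sheafificationAdjunction J D).IsMonoidal :=
  rightAdjoint_isMonoidal (sheafificationAdjunction J D)

/-- A sheaf is isomorphic to the sheaf associated with its underlying presheaf. -/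
def sheafIso : 𝟭 (Sheaf J D) ≅ sheafToPresheaf J D ⋙ presheafToSheaf J D :=
  (asIso (sheafificationAdjunction J D).counit).symm

instance : NatTrans.IsMonoidal (sheafIso J D).inv :=
  inferInstanceAs (NatTrans.IsMonoidal (sheafificationAdjunction J D).counit)

instance : NatTrans.IsMonoidal (sheafIso J D).hom :=
  have : NatTrans.IsMonoidal (sheafIso J D).symm.hom :=
    inferInstanceAs (NatTrans.IsMonoidal (sheafIso J D).inv)
  inferInstanceAs (NatTrans.IsMonoidal (sheafIso J D).symm.inv)

variable {J D}

/-- The endofunctor of sheaves which is induced by an endofunctor of presheaves. -/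
abbrev onSheaves (J : GrothendieckTopology C) [HasWeakSheafify J D] (L : (Cᵒᵖ ⥤ D) ⥤ Cᵒᵖ ⥤ D) :
    Sheaf J D ⥤ Sheaf J D :=
  sheafToPresheaf J D ⋙ L ⋙ presheafToSheaf J D

/-- The transformation from a sheaf to the associated sheaf of `L F`. -/
def toOnSheaves (J : GrothendieckTopology C) [HasWeakSheafify J D] {L : (Cᵒᵖ ⥤ D) ⥤ Cᵒᵖ ⥤ D}
    (τ : 𝟭 (Cᵒᵖ ⥤ D) ⟶ L) : 𝟭 (Sheaf J D) ⟶ onSheaves J L :=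
  (sheafIso J D).hom ≫ Functor.whiskerLeft (sheafToPresheaf J D)
    ((Functor.leftUnitor _).inv ≫ Functor.whiskerRight τ (presheafToSheaf J D))

instance (L : (Cᵒᵖ ⥤ D) ⥤ Cᵒᵖ ⥤ D) [L.LaxBraided] (τ : 𝟭 (Cᵒᵖ ⥤ D) ⟶ L)
    [NatTrans.IsMonoidal τ] : NatTrans.IsMonoidal (toOnSheaves J τ) :=
  inferInstanceAs (NatTrans.IsMonoidal (_ ≫ _))

section DirectImage

variable {C' : Type u₂} [Category.{v₂} C'] (K : GrothendieckTopology C') (G : C' ⥤ C)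
  [G.IsContinuous K J] [HasWeakSheafify K D] [(K.W (A := D)).IsMonoidal]

/-- The direct image of a sheaf is the sheaf associated with the direct image presheaf. -/
def directImageIso : sheafToPresheaf J D ⋙ (Functor.whiskeringLeft _ _ D).obj G.op ⋙
    presheafToSheaf K D ≅ G.sheafPushforwardContinuous D K J :=
  (Functor.isoWhiskerLeft (G.sheafPushforwardContinuous D K J) (sheafIso K D)).symm

instance directImageLaxBraided : (G.sheafPushforwardContinuous D K J).LaxBraided :=
  laxBraidedTransport (directImageIso (J := J) (D := D) K G)

end DirectImage

/-- The functor of sections over `U`. -/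
abbrev sections (J : GrothendieckTopology C) (D : Type u₁) [Category.{v₁} D] (U : C) :
    Sheaf J D ⥤ D :=
  sheafToPresheaf J D ⋙ (evaluation Cᵒᵖ D).obj (op U)

end Sheaves

section Hypercohomology

variable {C : Type u} [Category.{v} C] [LocallySmall.{w} C] {J : GrothendieckTopology C}
  {X : Type w} (pt : X → GrothendieckTopology.Point.{w} J) {D : Type u₁} [Category.{v₁} D]
  [HasWeakSheafify J D] [HasFilteredColimitsOfSize.{w, w} D] [HasProducts.{w} D]

/-- The hypercohomology sheaf `H_X F`: the simple functor is applied objectwise to the cosimplicial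
Godement resolution of `F`, and the associated sheaf is taken. -/
def hypercohomology (s : (SimplexCategory ⥤ D) ⥤ D) : Sheaf J D ⥤ Sheaf J D :=
  onSheaves J (hyper (godement pt D) s)

/-- The morphism `ρ_F : F ⟶ H_X F`. -/
def toHypercohomology {s : (SimplexCategory ⥤ D) ⥤ D} (lam : 𝟭 D ⟶ Functor.const _ ⋙ s) :
    𝟭 (Sheaf J D) ⟶ hypercohomology pt s :=
  toOnSheaves J (toHyper (godement pt D) lam)

variable [MonoidalCategory D] [SymmetricCategory D]
  [∀ A : D, PreservesFilteredColimitsOfSize.{w, w} (tensorLeft A)] [(J.W (A := D)).IsMonoidal]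
  (s : (SimplexCategory ⥤ D) ⥤ D) [s.LaxBraided]

instance : (hypercohomology pt s).LaxBraided :=
  inferInstanceAs (onSheaves J (hyper (godement pt D) s)).LaxBraided

instance (lam : 𝟭 D ⟶ Functor.const _ ⋙ s) [NatTrans.IsMonoidal lam] :
    NatTrans.IsMonoidal (toHypercohomology pt lam) :=
  inferInstanceAs (NatTrans.IsMonoidal (toOnSheaves J (toHyper (godement pt D) lam)))

end Hypercohomology

/-! ### Cartan–Eilenberg categories and derived functors -/

section CartanEilenberg

variable {A : Type u₁} [Category.{v₁} A] (S W : MorphismProperty A)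

/-- An object `M` is CE-fibrant if every weak equivalence `Y ⟶ X` induces a bijection between the
morphisms `X ⟶ M` and the morphisms `Y ⟶ M` in the localization at the strong equivalences. -/
def IsFibrant (M : A) : Prop :=
  ∀ ⦃Y X : A⦄ (w : Y ⟶ X), W w →
    Function.Bijective fun g : S.Q.obj X ⟶ S.Q.obj M => S.Q.map w ≫ g

/-- A morphism `X ⟶ M` of the localization at the strong equivalences is a CE-fibrant model of `X`
if `M` is CE-fibrant and the morphism becomes invertible in the localization at the weak
equivalences. -/
def IsFibrantModel {X M : A} (f : S.Q.obj X ⟶ S.Q.obj M) : Prop :=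
  IsFibrant S W M ∧
    ∃ h : S.IsInvertedBy W.Q, IsIso ((Localization.Construction.lift W.Q h).map f)

/-- Right Cartan–Eilenberg categories: the strong equivalences belong to the saturation of the class
of weak equivalences, and every object has a CE-fibrant model. -/
structure IsRightCartanEilenberg : Prop where
  isInvertedBy : S.IsInvertedBy W.Q
  exists_model (X : A) : ∃ (M : A) (f : S.Q.obj X ⟶ S.Q.obj M), IsFibrantModel S W f

/-- The category `A` is right Cartan–Eilenberg and the morphisms `ρ_F : F ⟶ H F` are CE-fibrant
models. -/
structure IsCompatible {H : A ⥤ A} (ρ : 𝟭 A ⟶ H) : Prop extends IsRightCartanEilenberg S W where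
  isFibrantModel (F : A) : IsFibrantModel S W (S.Q.map (ρ.app F))

end CartanEilenberg

section Derived

variable {A : Type u₁} [Category.{v₁} A] {B : Type u₂} [Category.{v₂} B] (W : MorphismProperty A)
  (W' : MorphismProperty B) {H : A ⥤ A} (ρ : 𝟭 A ⟶ H) (F : A ⥤ B)

/-- The functor between the localizations which is given by `M ↦ F (H M)`. -/
abbrev derivedFunctor (h : W.IsInvertedBy (H ⋙ F ⋙ W'.Q)) : W.Localization ⥤ W'.Localization :=
  Localization.Construction.lift (H ⋙ F ⋙ W'.Q) h

/-- The transformation with components `F (ρ_M) : F M ⟶ F (H M)`. -/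
def derivedUnit (h : W.IsInvertedBy (H ⋙ F ⋙ W'.Q)) :
    F ⋙ W'.Q ⟶ W.Q ⋙ derivedFunctor W W' F h :=
  (Functor.leftUnitor _).inv ≫ Functor.whiskerRight ρ (F ⋙ W'.Q) ≫
    eqToHom (Localization.Construction.fac (H ⋙ F ⋙ W'.Q) h).symm

/-- The functor `M ↦ F (H M)` is, with the transformation induced by `ρ`, the right derived functor
of `F`. -/
def IsDerivedBy : Prop :=
  ∃ h : W.IsInvertedBy (H ⋙ F ⋙ W'.Q),
    (derivedFunctor W W' F h).IsRightDerivedFunctor (derivedUnit W W' ρ F h) W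

variable {A₀ : Type u₃} [Category.{v₃} A₀] {B₀ : Type u} [Category.{v} B₀]
  (W₀ : MorphismProperty A₀) (W₀' : MorphismProperty B₀) (H₀ : A₀ ⥤ A₀) (F₀ : A₀ ⥤ B₀)

/-- The functors `M ↦ F (H M)` and `M ↦ F₀ (H₀ M)` between the localizations commute with the
functors induced by the forgetful functors `U` and `U'`. -/
def DerivedCommute (H : A ⥤ A) (U : A ⥤ A₀) (U' : B ⥤ B₀) : Prop :=
  ∃ (h : W.IsInvertedBy (H ⋙ F ⋙ W'.Q)) (h₀ : W₀.IsInvertedBy (H₀ ⋙ F₀ ⋙ W₀'.Q))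
    (k : W.IsInvertedBy (U ⋙ W₀.Q)) (k' : W'.IsInvertedBy (U' ⋙ W₀'.Q)),
    derivedFunctor W W' F h ⋙ Localization.Construction.lift (U' ⋙ W₀'.Q) k' =
      Localization.Construction.lift (U ⋙ W₀.Q) k ⋙ derivedFunctor W₀ W₀' F₀ h₀

end Derived

/-! ### Equivalences -/

section Equivalences

section Exact

variable {D : Type u₁} [Category.{v₁} D] (E : MorphismProperty D)

/-- Filtered colimits preserve equivalences. -/
def FilteredColimitsExact [HasFilteredColimitsOfSize.{w, w} D] : Prop :=
  ∀ (I : Type w) [SmallCategory I] [IsFiltered I] (F G : I ⥤ D) (f : F ⟶ G),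
    (∀ i, E (f.app i)) → E (colimMap f)

/-- Products preserve equivalences. -/
def ProductsExact [HasProducts.{w} D] : Prop :=
  ∀ (I : Type w) (A B : I → D) (f : ∀ i, A i ⟶ B i), (∀ i, E (f i)) → E (Limits.Pi.map f)

end Exact

section Sheaves

variable {C : Type u} [Category.{v} C] {J : GrothendieckTopology C} {D : Type u₁}
  [Category.{v₁} D] (E : MorphismProperty D)

variable (J) in
/-- Global equivalences of sheaves: they are equivalences objectwise. -/
def globalEq : MorphismProperty (Sheaf J D) :=
  fun _ _ f => ∀ U : C, E (f.hom.app (op U))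

/-- Local equivalences of sheaves: they are equivalences on stalks. -/
def localEq [LocallySmall.{w} C] [HasFilteredColimitsOfSize.{w, w} D] {X : Type w}
    (pt : X → GrothendieckTopology.Point.{w} J) : MorphismProperty (Sheaf J D) :=
  fun _ _ f => ∀ x : X, E ((stalk D (pt x)).map f.hom)

end Sheaves

section Operads

variable {A : Type u₁} [Category.{v₁} A] [MonoidalCategory A] [SymmetricCategory A]

/-- The component of an operad in arity `l`. -/
abbrev Operad.component (A : Type u₁) [Category.{v₁} A] [MonoidalCategory A] [SymmetricCategory A]
    (l : Arity) : Operad A ⥤ A :=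
  Operad.forget A ⋙ (evaluation Arityᵒᵖ A).obj (op l)

variable (E : MorphismProperty A)

/-- Morphisms of operads which belong to `E` in each arity. -/
def operadEq : MorphismProperty (Operad A) :=
  fun _ _ f => ∀ l : Arity, E ((Operad.component A l).map f)

/-- Morphisms `(P, M) ⟶ (Q, N)` for which `P ⟶ Q` belongs to `E` in each arity and `M ⟶ N` belongs
to `E`. -/
def opAlgEq : MorphismProperty (OpAlg A) :=
  fun _ _ f => operadEq E ((OpAlg.operadFunctor A).map f) ∧ E ((OpAlg.algFunctor A).map f)

/-- Morphisms of algebras over a fixed operad which belong to `E`. -/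
def algebraEq (P : Operad A) : MorphismProperty (Algebra P) :=
  fun _ _ f => E ((Algebra.forget P).map f)

end Operads

end Equivalences

/-! ### Direct images and sections of operads and algebras -/

section Transfer

variable {A : Type u₁} [Category.{v₁} A] [MonoidalCategory A] [SymmetricCategory A]
  {B : Type u₂} [Category.{v₂} B] [MonoidalCategory B] [SymmetricCategory B]
  (W : MorphismProperty A) (W' : MorphismProperty B) {H : A ⥤ A} [H.LaxBraided]
  (ρ : 𝟭 A ⟶ H) [NatTrans.IsMonoidal ρ]

/-- The endofunctor `M ↦ ρ^* H(M)` of the category of `P`-algebras. -/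
abbrev algebraResolution (P : Operad A) : Algebra P ⥤ Algebra P :=
  Algebra.map H P ⋙ Algebra.restrict ((Operad.unitNat ρ).app P)

/-- The symmetric monoidal functor `F` induces right derived functors on operads, on pairs of an
operad and an algebra and on algebras over a fixed operad, all given by `M ↦ F (H M)`, and these are
compatible with the right derived functor of `F` under the forgetful functors. -/
structure HasDerivedStructures (F : A ⥤ B) [F.LaxBraided] : Prop where
  base : IsDerivedBy W W' ρ F
  operad : IsDerivedBy (operadEq W) (operadEq W') (Operad.unitNat ρ) (Operad.map F)
  operad_component (l : Arity) : DerivedCommute (operadEq W) (operadEq W') (Operad.map F) W W' H F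
    (Operad.map H) (Operad.component A l) (Operad.component B l)
  opAlg : IsDerivedBy (opAlgEq W) (opAlgEq W') (OpAlg.unitNat ρ) (OpAlg.map F)
  opAlg_operad : DerivedCommute (opAlgEq W) (opAlgEq W') (OpAlg.map F) (operadEq W) (operadEq W')
    (Operad.map H) (Operad.map F) (OpAlg.map H) (OpAlg.operadFunctor A) (OpAlg.operadFunctor B)
  opAlg_alg : DerivedCommute (opAlgEq W) (opAlgEq W') (OpAlg.map F) W W' H F (OpAlg.map H)
    (OpAlg.algFunctor A) (OpAlg.algFunctor B)
  algebra (P : Operad A) : IsDerivedBy (algebraEq W P) (algebraEq W' ((Operad.map F).obj P))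
    (Algebra.unitNat ρ P) (Algebra.map F P)
  algebra_forget (P : Operad A) : DerivedCommute (algebraEq W P)
    (algebraEq W' ((Operad.map F).obj P)) (Algebra.map F P) W W' H F (algebraResolution ρ P)
    (Algebra.forget P) (Algebra.forget ((Operad.map F).obj P))

end Transfer

attribute [instance] MonoidalDescentStructure.laxBraided MonoidalDescentStructure.μ_isMonoidal
  MonoidalDescentStructure.lam_isMonoidal

end

end SheafOperad

open SheafOperad

namespace SheafOperad

/-! ### Resolvent functors, Cartan–Eilenberg fibrancy and right derived functors -/

section Resolvent

variable {A : Type u₁} [Category.{v₁} A] {S W : MorphismProperty A}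

/-! CE-fibrancy is a statement about hom-sets of a localization, and a morphism in a localized
category of operads is not given arity by arity. So fibrancy cannot simply be read off the
components of an operad. The proof trades it for a condition on objects and morphisms of the
original category, and that condition can be checked arity by arity. A pair `(H, ρ)` with `ρ : 𝟭 ⟶
H` is called resolvent (`IsResolvent`) if `S ≤ W`, every `ρ_X` is in `W`, `H` takes `W` into `S`,
and every `ρ_{HX}` is in `S`.

When `S` and `W` are saturated, compatibility implies resolvence (`IsCompatible.isResolvent`). A
weak equivalence between fibrant objects is a strong one, by the usual Whitehead argument. This
applies to `H f` for `f` in `W` and to `ρ_{HX}`. Conversely, a resolvent pair is always compatible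
(`IsResolvent.isCompatible`), and here no saturation is needed. Since `H` preserves `S`, it descends
with `ρ` to the localization at `S`, and naturality of `ρ` there recovers a morphism into `H M` from
its image under `H`. As `H` makes weak equivalences invertible, `H M` is fibrant.

Saturation is thus needed only for the global and local equivalences of sheaves, where it is
inherited from `E`, because both classes are defined by functors to the descent category. For
operads, pairs and algebras over a fixed operad, each of the four conditions is the same condition
for the underlying sheaves, since `H` and `ρ` are applied to the underlying sheaves. This passage
from compatible sheaves to a resolvent pair, then to structures, and back to compatibility gives the
first assertion.

For the derived functors, let `F` take `S` into `W'`. Then `F ∘ H` takes `W` into `W'`, and the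
functor it induces on localizations, with unit `F(ρ)`, is a left Kan extension of `F` along the
localization functor (`isLeftKanExtension_of_resolution`). This is the universal property of a right
derived functor. The hypothesis on `F` is again tested on underlying objects. It holds for sections
over `U` by the definition of global equivalences. For a direct image, global equivalences remain
global, and global equivalences are local because stalks are filtered colimits. The forgetful
functors commute strictly with `H` and with `F`, hence also with the induced functors on
localizations. -/

/-- `F` descends to a functor between the localizations at `W` and at `E`, so it sends a morphism
inverted at `W` to one inverted at `E`, and saturation of `E` applies. Consequently a class
consisting of the morphisms that a family of functors takes into a saturated class is itself
saturated. -/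
lemma map_mem_of_isIso_map_Q {D : Type u₂} [Category.{v₂} D] {E : MorphismProperty D}
    (hE : IsSaturated E) (F : A ⥤ D) (hF : ∀ ⦃X Y : A⦄ (f : X ⟶ Y), W f → E (F.map f))
    {X Y : A} (f : X ⟶ Y) (hf : IsIso (W.Q.map f)) : E (F.map f) := by
  have h : W.IsInvertedBy (F ⋙ E.Q) := fun _ _ g hg => E.Q_inverts _ (hF g hg)
  refine hE _ ?_
  have e := eqToIso (Localization.Construction.fac (F ⋙ E.Q) h)
  exact (NatIso.isIso_map_iff e f).1
    (inferInstanceAs (IsIso ((Localization.Construction.lift (F ⋙ E.Q) h).map (W.Q.map f))))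

/-- In the localization `f` is conjugate to the invertible `g`. This allows the stalk to be computed
by a different colimit diagram. -/
lemma IsSaturated.mem_of_comp_iso {D : Type u₂} [Category.{v₂} D] {E : MorphismProperty D}
    (hE : IsSaturated E) {X Y X' Y' : D} {f : X ⟶ Y} {g : X' ⟶ Y'} (a : X ≅ X') (b : Y ≅ Y')
    (h : a.hom ≫ g = f ≫ b.hom) (hg : E g) : E f := by
  refine hE f ?_
  have := E.Q_inverts g hg
  have h' : E.Q.map f = E.Q.map a.hom ≫ E.Q.map g ≫ E.Q.map b.inv := by
    rw [← Functor.map_comp, ← Functor.map_comp, reassoc_of% h, Iso.hom_inv_id, Category.comp_id]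
  rw [h']
  infer_instance

/-- A resolvent functor: a functorial replacement of objects up to weak equivalences which takes
weak equivalences to strong equivalences and which is idempotent up to strong equivalences. -/
structure IsResolvent (S W : MorphismProperty A) {H : A ⥤ A} (ρ : 𝟭 A ⟶ H) : Prop where
  le : S ≤ W
  mem (X : A) : W (ρ.app X)
  map_mem {X Y : A} (f : X ⟶ Y) (hf : W f) : S (H.map f)
  obj_mem (X : A) : S (ρ.app (H.obj X))

/-- Weak equivalences between fibrant objects are strong equivalences. -/
lemma IsFibrant.mem_of_mem (hS : IsSaturated S) {X Y : A} (hX : IsFibrant S W X)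
    (hY : IsFibrant S W Y) (f : X ⟶ Y) (hf : W f) : S f := by
  -- Fibrancy of `X` yields a left-hand inverse `g` with `f ≫ g = 𝟙` in the localization at `S`.
  -- Fibrancy of `Y` makes precomposition with `f` injective, so the other identity may be checked
  -- after precomposing with `f`.
  obtain ⟨g, hg⟩ := (hX f hf).2 (𝟙 _)
  dsimp only at hg
  refine hS f ⟨g, hg, (hY f hf).1 ?_⟩
  dsimp only
  rw [reassoc_of% hg, Category.comp_id]

variable {H : A ⥤ A} {ρ : 𝟭 A ⟶ H}

/-- If `ρ : 𝟭 A ⟶ H` is inverted by the localization functor `L` and `ρ` is inverted by `F` on the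
values of `H`, the functor induced by `H ⋙ F` is a left Kan extension of `F` along `L`. -/
lemma isLeftKanExtension_of_resolution (ρ : 𝟭 A ⟶ H) (W : MorphismProperty A)
    {A' : Type u₂} [Category.{v₂} A'] (L : A ⥤ A') [L.IsLocalization W]
    {B : Type u₃} [Category.{v₃} B] (F : A ⥤ B) (hρ : ∀ M, IsIso (L.map (ρ.app M)))
    (hF : ∀ M, IsIso (F.map (ρ.app (H.obj M)))) (R : A' ⥤ B) (e : H ⋙ F ≅ L ⋙ R) :
    R.IsLeftKanExtension
      ((Functor.leftUnitor F).inv ≫ Functor.whiskerRight ρ F ≫ e.hom : F ⟶ L ⋙ R) := by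
  -- Uniqueness. At the objects `H M` the unit component `F(ρ_{HM})` is invertible and can be
  -- cancelled. Naturality along the isomorphism `L(ρ_M)` carries the equality from `H M` to `M`.
  have hext (G : A' ⥤ B) (m m' : R ⟶ G) (hm : ∀ M, F.map (ρ.app M) ≫ e.hom.app M ≫
      m.app (L.obj M) = F.map (ρ.app M) ≫ e.hom.app M ≫ m'.app (L.obj M)) : m = m' := by
    refine Localization.natTrans_ext L W fun M => ?_
    have hH : m.app (L.obj (H.obj M)) = m'.app (L.obj (H.obj M)) := by
      simpa only [cancel_epi] using hm (H.obj M)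
    rw [← cancel_mono (G.map (L.map (ρ.app M))), ← m.naturality, ← m'.naturality]
    exact congrArg (_ ≫ ·) hH
  -- Existence. The formula is forced: compare `M` with `H M`, apply `φ` there, and return along the
  -- inverse of `G(L(ρ_M))`.
  have hex (G : A' ⥤ B) (φ : F ⟶ L ⋙ G) : ∃ ψ : R ⟶ G, ∀ M : A,
      ψ.app (L.obj M) = e.inv.app M ≫ φ.app (H.obj M) ≫ inv (G.map (L.map (ρ.app M))) := by
    let τ : L ⋙ R ⟶ L ⋙ G := e.inv ≫
      { app M := φ.app (H.obj M) ≫ inv (G.map (L.map (ρ.app M)))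
        naturality M N f := by
          have h1 := φ.naturality (H.map f)
          have h2 := congrArg (fun x => G.map (L.map x)) (ρ.naturality f)
          dsimp at h1 h2 ⊢
          rw [reassoc_of% h1, Category.assoc]
          simp only [Functor.map_comp] at h2
          rw [← cancel_mono (G.map (L.map (ρ.app N)))]
          simp [h2] }
    -- `τ` is natural only on objects and morphisms of `A`. Fullness of restriction along `L`
    -- extends it to the whole localization.
    obtain ⟨ψ, hψ⟩ := (Localization.full_whiskeringLeft L W B).map_surjective (X := R) (Y := G) τ
    exact ⟨ψ, NatTrans.congr_app hψ⟩
  choose ψ hψ using hex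
  have hfac (G : A' ⥤ B) (φ : F ⟶ L ⋙ G) (M : A) :
      F.map (ρ.app M) ≫ e.hom.app M ≫ (ψ G φ).app (L.obj M) = φ.app M := by
    -- Naturality of `φ` at `ρ_M` replaces `F(ρ_M) ≫ φ_{HM}` by `φ_M ≫ G(L(ρ_M))`, whose last factor
    -- cancels against the inverse in the formula for `ψ`.
    have h1 := φ.naturality (ρ.app M)
    dsimp at h1
    rw [hψ, e.hom_inv_id_app_assoc, reassoc_of% h1, IsIso.hom_inv_id, Category.comp_id]
  have hα (M : A) {Y : B} (g : R.obj (L.obj M) ⟶ Y) : ((Functor.leftUnitor F).inv ≫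
      Functor.whiskerRight ρ F ≫ e.hom : F ⟶ L ⋙ R).app M ≫ g =
        F.map (ρ.app M) ≫ e.hom.app M ≫ g := by
    simp
  -- A left Kan extension is an initial object among the functors `G` equipped with a transformation
  -- `F ⟶ L ⋙ G`.
  refine ⟨⟨Limits.IsInitial.ofUniqueHom (fun G => StructuredArrow.homMk (ψ G.right G.hom)
    (NatTrans.ext (funext fun M => (hα M _).trans (hfac G.right G.hom M)))) fun G m =>
    StructuredArrow.hom_ext _ _ (hext _ _ _ fun M => ?_)⟩⟩
  exact (hα M _).symm.trans ((NatTrans.congr_app (StructuredArrow.w m) M).trans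
    (hfac G.right G.hom M).symm)

/-- The lift composed with `S.Q` is `W.Q`. For a model that comes from a morphism of `A`, the
invertibility in `IsFibrantModel` can therefore be tested directly with `W.Q`. -/
lemma isIso_lift_map_iff (h : S.IsInvertedBy W.Q) {X Y : A} (f : X ⟶ Y) :
    IsIso ((Localization.Construction.lift W.Q h).map (S.Q.map f)) ↔ IsIso (W.Q.map f) :=
  NatIso.isIso_map_iff (eqToIso (Localization.Construction.fac W.Q h)) f

/-- All values of `H` are fibrant, so it suffices that `H f`, for `f` in `W`, and `ρ_{HX}` lie in
`W`: between fibrant objects this already places them in `S`. Saturation of `W` turns invertibility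
in the localization into membership, and saturation of `S` enters through `IsFibrant.mem_of_mem`. -/
lemma IsCompatible.isResolvent (h : IsCompatible S W ρ) (hS : IsSaturated S)
    (hW : IsSaturated W) : IsResolvent S W ρ := by
  have hfib (X : A) : IsFibrant S W (H.obj X) := (h.isFibrantModel X).1
  have hiso (X : A) : IsIso (W.Q.map (ρ.app X)) := by
    obtain ⟨-, h', hX⟩ := h.isFibrantModel X
    exact (isIso_lift_map_iff h' _).1 hX
  refine ⟨fun X Y f hf => hW f (h.isInvertedBy f hf), fun X => hW _ (hiso X),
    fun {X Y} f hf => (hfib X).mem_of_mem hS (hfib Y) _ (hW _ ?_),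
    fun X => (hfib X).mem_of_mem hS (hfib _) _ (hW _ (hiso _))⟩
  have := W.Q_inverts f hf
  -- In the naturality square of `ρ` at `f`, three sides are inverted by `W.Q`, hence so is the
  -- fourth side `H f`.
  have e : W.Q.map (ρ.app X) ≫ W.Q.map (H.map f) = W.Q.map f ≫ W.Q.map (ρ.app Y) := by
    rw [← Functor.map_comp, ← Functor.map_comp]
    exact congrArg W.Q.map (ρ.naturality f).symm
  have : IsIso (W.Q.map (ρ.app X) ≫ W.Q.map (H.map f)) := by
    rw [e]
    infer_instance
  exact IsIso.of_isIso_comp_left (W.Q.map (ρ.app X)) _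

namespace IsResolvent

variable (h : IsResolvent S W ρ)

include h

/-- A morphism `g` into `H M` is recovered from its image under the functor induced by `H`, because
`ρ_{HM}` is invertible in the localization at `S`. That functor turns `w` into an isomorphism, so
morphisms out of `X` and out of `Y` correspond. -/
lemma bijective_comp_of_isLocalization {B : Type u₂} [Category.{v₂} B] (L : A ⥤ B)
    [L.IsLocalization S] (M : A) {X Y : A} (w : Y ⟶ X) (hw : W w) :
    Function.Bijective fun g : L.obj X ⟶ L.obj (H.obj M) => L.map w ≫ g := by
  -- `H` preserves `S` because `S ≤ W` and `H` takes `W` into `S`. Hence it descends to an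
  -- endofunctor `K` of the localization.
  have hH : S.IsInvertedBy (H ⋙ L) := fun _ _ f hf =>
    Localization.inverts L S _ (h.map_mem f (h.le _ hf))
  let K : B ⥤ B := Localization.lift (H ⋙ L) hH L
  let e : L ⋙ K ≅ H ⋙ L := Localization.fac (H ⋙ L) hH L
  -- The extension of `ρ` to a transformation `𝟭 ⟶ K` on the localization.
  obtain ⟨τ, hτ⟩ := (Localization.full_whiskeringLeft L S B).map_surjective
    (X := 𝟭 B) (Y := K)
    (show L ⋙ 𝟭 B ⟶ L ⋙ K from (Functor.rightUnitor L).hom ≫ (Functor.leftUnitor L).inv ≫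
      Functor.whiskerRight ρ L ≫ e.inv)
  -- Naturality of `ρ` now holds for every morphism of the localization, including those that do not
  -- come from `A`.
  have hρ {U V : A} (g : L.obj U ⟶ L.obj V) :
      g ≫ L.map (ρ.app V) = L.map (ρ.app U) ≫ e.inv.app U ≫ K.map g ≫ e.hom.app V := by
    have hτ' (U : A) : τ.app (L.obj U) = L.map (ρ.app U) ≫ e.inv.app U := by
      have := NatTrans.congr_app hτ U
      simpa using! this
    have := τ.naturality g
    rw [hτ', hτ'] at this
    rw [← Category.assoc (L.map _), ← Category.assoc, ← this]
    simp
  have : IsIso (L.map (ρ.app (H.obj M))) := Localization.inverts L S _ (h.obj_mem M)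
  have : IsIso (K.map (L.map w)) := by
    have : IsIso ((H ⋙ L).map w) := Localization.inverts L S _ (h.map_mem w hw)
    exact (NatIso.isIso_map_iff e w).2 this
  constructor
  · intro g₁ g₂ hg
    dsimp only at hg
    have hg' := congrArg K.map hg
    rw [K.map_comp, K.map_comp, cancel_epi] at hg'
    rw [← cancel_mono (L.map (ρ.app (H.obj M))), hρ, hρ, hg']
  · intro g
    -- Up to the comparison `e`, the preimage of `g` is `ρ_X`, followed by `K(w)⁻¹ ≫ K(g)`, followed
    -- by `ρ_{HM}⁻¹`. Naturality at `w` and then at `g` shows that precomposing it with `w` gives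
    -- back `g`.
    refine ⟨L.map (ρ.app X) ≫ e.inv.app X ≫ inv (K.map (L.map w)) ≫ K.map g ≫
      e.hom.app (H.obj M) ≫ inv (L.map (ρ.app (H.obj M))), ?_⟩
    dsimp only
    rw [reassoc_of% (hρ (L.map w)), e.hom_inv_id_app_assoc, IsIso.hom_inv_id_assoc]
    have := hρ g
    rw [← cancel_mono (L.map (ρ.app (H.obj M))), this]
    simp

lemma isFibrant (M : A) : IsFibrant S W (H.obj M) :=
  fun _ _ w hw => h.bijective_comp_of_isLocalization S.Q M w hw

/-- No saturation is assumed, which is what makes this direction usable for operads and algebras.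
The fibrant models are the morphisms `ρ_X` themselves. -/
lemma isCompatible : IsCompatible S W ρ := by
  have hi : S.IsInvertedBy W.Q := fun _ _ f hf => W.Q_inverts f (h.le _ hf)
  have hm (X : A) : IsFibrantModel S W (S.Q.map (ρ.app X)) :=
    ⟨h.isFibrant X, hi, (isIso_lift_map_iff hi _).2 (W.Q_inverts _ (h.mem X))⟩
  exact ⟨⟨hi, fun X => ⟨_, _, hm X⟩⟩, hm⟩

lemma isInvertedBy {B : Type u₂} [Category.{v₂} B] {W' : MorphismProperty B} {F : A ⥤ B}
    (hF : ∀ ⦃X Y : A⦄ (f : X ⟶ Y), S f → W' (F.map f)) : W.IsInvertedBy (H ⋙ F ⋙ W'.Q) :=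
  fun _ _ f hf => W'.Q_inverts _ (hF _ (h.map_mem f hf))

/-- Both invertibility conditions for the Kan extension are available: `ρ_M` is in `W`, and
`F(ρ_{HM})` is in `W'` because `ρ_{HM}` is in `S`. -/
lemma isDerivedBy {B : Type u₂} [Category.{v₂} B] {W' : MorphismProperty B} {F : A ⥤ B}
    (hF : ∀ ⦃X Y : A⦄ (f : X ⟶ Y), S f → W' (F.map f)) : IsDerivedBy W W' ρ F := by
  have hi := h.isInvertedBy hF
  have hρ (M : A) : IsIso (W.Q.map (ρ.app M)) := W.Q_inverts _ (h.mem M)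
  have hFρ (M : A) : IsIso ((F ⋙ W'.Q).map (ρ.app (H.obj M))) :=
    W'.Q_inverts _ (hF _ (h.obj_mem M))
  exact ⟨hi, ⟨isLeftKanExtension_of_resolution ρ W W.Q (F ⋙ W'.Q) hρ hFρ _
    (eqToIso (Localization.Construction.fac (H ⋙ F ⋙ W'.Q) hi).symm)⟩⟩

end IsResolvent

/-- Functors between localizations that are given by functors which commute strictly. -/
lemma derivedCommute_of_eq {B : Type u₂} [Category.{v₂} B] {W' : MorphismProperty B} {F : A ⥤ B}
    {A₀ : Type u₃} [Category.{v₃} A₀] {B₀ : Type u} [Category.{v} B₀]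
    {W₀ : MorphismProperty A₀} {W₀' : MorphismProperty B₀} {H₀ : A₀ ⥤ A₀} {F₀ : A₀ ⥤ B₀}
    {U : A ⥤ A₀} {U' : B ⥤ B₀}
    (h : W.IsInvertedBy (H ⋙ F ⋙ W'.Q)) (h₀ : W₀.IsInvertedBy (H₀ ⋙ F₀ ⋙ W₀'.Q))
    (k : ∀ ⦃X Y : A⦄ (f : X ⟶ Y), W f → W₀ (U.map f))
    (k' : ∀ ⦃X Y : B⦄ (f : X ⟶ Y), W' f → W₀' (U'.map f))
    (e : H ⋙ F ⋙ U' = U ⋙ H₀ ⋙ F₀) :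
    DerivedCommute W W' F W₀ W₀' H₀ F₀ H U U' := by
  have hk : W.IsInvertedBy (U ⋙ W₀.Q) := fun _ _ f hf => W₀.Q_inverts _ (k f hf)
  have hk' : W'.IsInvertedBy (U' ⋙ W₀'.Q) := fun _ _ f hf => W₀'.Q_inverts _ (k' f hf)
  -- Functors out of the constructed localization that agree after composition with `W.Q` are equal,
  -- so the strict equality `e` yields an equality of the induced functors and not merely an
  -- isomorphism.
  refine ⟨h, h₀, hk, hk', Localization.Construction.uniq _ _ ?_⟩
  calc
    _ = (H ⋙ F) ⋙ W'.Q ⋙ Localization.Construction.lift (U' ⋙ W₀'.Q) hk' :=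
      congrArg (· ⋙ Localization.Construction.lift (U' ⋙ W₀'.Q) hk')
        (Localization.Construction.fac (H ⋙ F ⋙ W'.Q) h)
    _ = (H ⋙ F ⋙ U') ⋙ W₀'.Q :=
      congrArg ((H ⋙ F) ⋙ ·) (Localization.Construction.fac _ hk')
    _ = U ⋙ W₀.Q ⋙ derivedFunctor W₀ W₀' F₀ h₀ := by
      rw [e]
      exact congrArg (U ⋙ ·) (Localization.Construction.fac (H₀ ⋙ F₀ ⋙ W₀'.Q) h₀).symm
    _ = _ := congrArg (· ⋙ derivedFunctor W₀ W₀' F₀ h₀) (Localization.Construction.fac _ hk).symm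

end Resolvent

/-! ### Passage from underlying objects to operads and algebras -/

section OperadicResolvent

variable {A : Type u₁} [Category.{v₁} A] [MonoidalCategory A] [SymmetricCategory A]
  {S W : MorphismProperty A} {H : A ⥤ A} [H.LaxBraided] {ρ : 𝟭 A ⟶ H} [NatTrans.IsMonoidal ρ]

namespace IsResolvent

/-- In arity `l` the morphism `P ⟶ H(P)` is `ρ` at `P(l)`, and `H` acts on morphisms arity by arity.
Each condition is thus the given one at every component. -/
lemma operad (h : IsResolvent S W ρ) :
    IsResolvent (operadEq S) (operadEq W) (Operad.unitNat ρ) where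
  le _ _ _ hf l := h.le _ (hf l)
  mem P l := h.mem (P.obj l)
  map_mem _ hf l := h.map_mem _ (hf l)
  obj_mem P l := h.obj_mem (P.obj l)

lemma opAlg (h : IsResolvent S W ρ) :
    IsResolvent (opAlgEq S) (opAlgEq W) (OpAlg.unitNat ρ) where
  le _ _ _ hf := ⟨h.operad.le _ hf.1, h.le _ hf.2⟩
  mem P := ⟨h.operad.mem P.operad, h.mem P.alg.X⟩
  map_mem _ hf := ⟨h.operad.map_mem _ hf.1, h.map_mem _ hf.2⟩
  obj_mem P := ⟨h.operad.obj_mem P.operad, h.obj_mem P.alg.X⟩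

/-- Restriction along `P ⟶ H(P)` changes the action but not the underlying object, so the
endofunctor `algebraResolution` is `H` on underlying objects and its unit is `ρ` there. -/
lemma algebra (h : IsResolvent S W ρ) (P : Operad A) :
    IsResolvent (algebraEq S P) (algebraEq W P) (Algebra.unitNat ρ P) where
  le _ _ _ hf := h.le _ hf
  mem M := h.mem M.X
  map_mem _ hf := h.map_mem _ hf
  obj_mem M := h.obj_mem M.X

/-- A single hypothesis on `F` suffices for all structures, since strong equivalences of the source
and equivalences of the target are both tested on the components to which `F` is applied. -/
lemma hasDerivedStructures (h : IsResolvent S W ρ) {B : Type u₂} [Category.{v₂} B]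
    [MonoidalCategory B] [SymmetricCategory B] {W' : MorphismProperty B} (F : A ⥤ B) [F.LaxBraided]
    (hF : ∀ ⦃X Y : A⦄ (f : X ⟶ Y), S f → W' (F.map f)) : HasDerivedStructures W W' ρ F := by
  have hop : ∀ ⦃X Y : Operad A⦄ (f : X ⟶ Y), operadEq S f → operadEq W' ((Operad.map F).map f) :=
    fun _ _ _ hf l => hF _ (hf l)
  have hoa : ∀ ⦃X Y : OpAlg A⦄ (f : X ⟶ Y), opAlgEq S f → opAlgEq W' ((OpAlg.map F).map f) :=
    fun _ _ _ hf => ⟨hop _ hf.1, hF _ hf.2⟩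
  have hal (P : Operad A) : ∀ ⦃X Y : Algebra P⦄ (f : X ⟶ Y), algebraEq S P f →
      algebraEq W' ((Operad.map F).obj P) ((Algebra.map F P).map f) :=
    fun _ _ _ hf => hF _ hf
  exact
    { base := h.isDerivedBy hF
      operad := h.operad.isDerivedBy hop
      -- In this and the other commutation fields the square of forgetful functors commutes
      -- definitionally, because the images of a structure under `H` and `F` are carried by the
      -- images of its underlying objects.
      operad_component l := derivedCommute_of_eq (h.operad.isInvertedBy hop) (h.isInvertedBy hF)
        (fun _ _ _ hf => hf l) (fun _ _ _ hf => hf l) rfl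
      opAlg := h.opAlg.isDerivedBy hoa
      opAlg_operad := derivedCommute_of_eq (h.opAlg.isInvertedBy hoa) (h.operad.isInvertedBy hop)
        (fun _ _ _ hf => hf.1) (fun _ _ _ hf => hf.1) rfl
      opAlg_alg := derivedCommute_of_eq (h.opAlg.isInvertedBy hoa) (h.isInvertedBy hF)
        (fun _ _ _ hf => hf.2) (fun _ _ _ hf => hf.2) rfl
      algebra P := (h.algebra P).isDerivedBy (hal P)
      algebra_forget P := derivedCommute_of_eq ((h.algebra P).isInvertedBy (hal P))
        (h.isInvertedBy hF) (fun _ _ _ hf => hf) (fun _ _ _ hf => hf) rfl }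

lemma isCompatible_structures (h : IsResolvent S W ρ) :
    IsCompatible (operadEq S) (operadEq W) (Operad.unitNat ρ) ∧
      IsCompatible (opAlgEq S) (opAlgEq W) (OpAlg.unitNat ρ) ∧
      ∀ P : Operad A, IsCompatible (algebraEq S P) (algebraEq W P) (Algebra.unitNat ρ P) :=
  ⟨h.operad.isCompatible, h.opAlg.isCompatible, fun P => (h.algebra P).isCompatible⟩

end IsResolvent

end OperadicResolvent

/-! ### Global and local equivalences of sheaves -/

section SheafEquivalences

variable {C : Type u} [Category.{v} C] {J : GrothendieckTopology C} {D : Type u₁}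
  [Category.{v₁} D] {E : MorphismProperty D}

/-- The class is defined by the section functors, each of which takes it into the saturated class
`E`. -/
lemma isSaturated_globalEq (hE : IsSaturated E) : IsSaturated (globalEq J E) :=
  fun _ _ f hf U => map_mem_of_isIso_map_Q hE
    (sheafToPresheaf J D ⋙ (evaluation Cᵒᵖ D).obj (op U)) (fun _ _ _ hg => hg U) f hf

variable [LocallySmall.{w} C] [HasFilteredColimitsOfSize.{w, w} D]

/-- The same argument, with stalk functors in place of section functors. -/
lemma isSaturated_localEq (hE : IsSaturated E) {X : Type w}
    (pt : X → GrothendieckTopology.Point.{w} J) : IsSaturated (localEq E pt) :=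
  fun _ _ f hf x => map_mem_of_isIso_map_Q hE (sheafToPresheaf J D ⋙ stalk D (pt x))
    (fun _ _ _ hg => hg x) f hf

/-- The stalk is a colimit over the category of neighbourhoods of the point, which is filtered but
need not be small. Exactness is assumed for small filtered colimits only, so the diagram is first
restricted along a final functor from a small filtered category. -/
lemma stalk_map_mem (hE : IsSaturated E) (hcolim : FilteredColimitsExact.{w} E)
    (Φ : GrothendieckTopology.Point.{w} J) {F G : Cᵒᵖ ⥤ D} (f : F ⟶ G)
    (hf : ∀ U : C, E (f.app (op U))) : E ((stalk D Φ).map f) := by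
  let K := FinallySmall.fromFilteredFinalModel.{w} Φ.fiber.Elementsᵒᵖ
  let e := Functor.Final.colimIso (E := D) K
  let π := (Functor.whiskeringLeft _ _ D).obj (CategoryOfElements.π Φ.fiber).op
  -- Finality identifies the two colimits naturally in the presheaf, so the stalk map is isomorphic
  -- as an arrow to a small filtered colimit of morphisms in `E`.
  exact hE.mem_of_comp_iso (e.symm.app (π.obj F)) (e.symm.app (π.obj G))
    (e.inv.naturality (π.map f)).symm
    (hcolim _ _ _ (Functor.whiskerLeft K (π.map f)) fun i => hf _)

lemma globalEq_le_localEq (hE : IsSaturated E) (hcolim : FilteredColimitsExact.{w} E)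
    {X : Type w} (pt : X → GrothendieckTopology.Point.{w} J) : globalEq J E ≤ localEq E pt :=
  fun _ _ f hf x => stalk_map_mem hE hcolim (pt x) f.hom hf

end SheafEquivalences

end SheafOperad

/-! ### The theorem for hypercohomology, direct images and sections -/

theorem theorem3p4p9 {C : Type u} [Category.{v} C] [LocallySmall.{w} C]
    (J : GrothendieckTopology C) {X : Type w} (pt : X → GrothendieckTopology.Point.{w} J)
    (hpt : (ObjectProperty.ofObj pt).IsConservativeFamilyOfPoints)
    {D : Type u₁} [Category.{v₁} D] [MonoidalCategory D] [SymmetricCategory D]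
    [HasFiniteProducts D] [HasLimitsOfSize.{w, w} D] [HasFilteredColimitsOfSize.{w, w} D]
    [AB5OfSize.{w, w} D] [∀ A : D, PreservesFilteredColimitsOfSize.{w, w} (tensorLeft A)]
    [HasWeakSheafify J D] [(J.W (A := D)).IsMonoidal]
    (E : MorphismProperty D) (desc : MonoidalDescentStructure E)
    (hcolim : FilteredColimitsExact.{w} E) (hprod : ProductsExact.{w} E)
    (hcompat : IsCompatible (globalEq J E) (localEq E pt) (toHypercohomology pt desc.lam)) :
    (IsCompatible (operadEq (globalEq J E)) (operadEq (localEq E pt))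
        (Operad.unitNat (toHypercohomology pt desc.lam)) ∧
      IsCompatible (opAlgEq (globalEq J E)) (opAlgEq (localEq E pt))
        (OpAlg.unitNat (toHypercohomology pt desc.lam)) ∧
      ∀ P : Operad (Sheaf J D), IsCompatible (algebraEq (globalEq J E) P)
        (algebraEq (localEq E pt) P) (Algebra.unitNat (toHypercohomology pt desc.lam) P)) ∧
    (∀ (C' : Type u₂) [Category.{v₂} C'] [LocallySmall.{w} C'] (K : GrothendieckTopology C')
      {Y : Type w} (pt' : Y → GrothendieckTopology.Point.{w} K)
      (_ : (ObjectProperty.ofObj pt').IsConservativeFamilyOfPoints)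
      [HasWeakSheafify K D] [(K.W (A := D)).IsMonoidal] (G : C' ⥤ C) [G.IsContinuous K J],
      HasDerivedStructures (localEq E pt) (localEq E pt') (toHypercohomology pt desc.lam)
        (G.sheafPushforwardContinuous D K J)) ∧
    ∀ U : C, HasDerivedStructures (localEq E pt) E (toHypercohomology pt desc.lam)
      (sections J D U) := by
  -- The compatibility of sheaves enters only here. Everything afterwards uses the four resolvent
  -- conditions.
  have h := hcompat.isResolvent (isSaturated_globalEq desc.saturated)
    (isSaturated_localEq desc.saturated pt)
  refine ⟨h.isCompatible_structures, ?_,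
    fun U => h.hasDerivedStructures _ fun _ _ f hf => hf U⟩
  intro C' _ _ K Y pt' _ _ _ G _
  -- The direct image has sections `(f_* φ)(U) = φ(G U)`, so it preserves global equivalences. On
  -- the target site these are local equivalences.
  exact h.hasDerivedStructures _ fun _ _ f hf =>
    globalEq_le_localEq desc.saturated hcolim pt' _ fun U => hf (G.obj U)
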